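/- Let $\mathbb{P}=\{1,2,3,\dots\}$ and let $\mathbb{P}^{\pm}$ be the set of nonzero integers, totally ordered by $-1<1<-2<2<-3<3<\cdots$. A labelled weighted poset on $[n]=\{1,\dots,n\}$ is a strict partial order $<_P$ on $[n]$ with a weight function $\epsilon:[n]\to\mathbb{P}$. An enriched $P$-partition is a map $f:[n]\to\mathbb{P}^{\pm}$ such that, whenever $i<_P j$: if $i<j$ then $f(i)<f(j)$ or $f(i)=f(j)>0$ (i.e. $f(i)=f(j)\in\mathbb P$); if $i>j$ then $f(i)<f(j)$ or $f(i)=f(j)\in-\mathbb P$. For $q\in\mathbb{C}$ put $$\Gamma^{(q)}([n],<_P,\epsilon)=\sum_{f}\ \prod_{1\le i\le n}q^{[f(i)<0]}\,x_{|f(i)|}^{\epsilon(i)}\in\mathbb{C}[[x_1,x_2,\dots]],$$ the sum being over all enriched $P$-partitions $f$, with $[f(i)<0]=1$ if $f(i)\in-\mathbb P$ and $0$ otherwise. For a permutation $\pi\in S_n$ ($n\ge 0$) let $L^{(q)}_\pi$ be $\Gamma^{(q)}$ of the chain $\pi_1<_\pi\pi_2<_\pi\cdots<_\pi\pi_n$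 with all weights equal to $1$. It depends only on the descent set $\{1\le i\le n-1:\pi_i>\pi_{i+1}\}$, and for $I\subseteq\{1,\dots,n-1\}$ the $q$-fundamental $L^{(q)}_{n,I}$ is $L^{(q)}_\pi$ for any $\pi\in S_n$ with descent set $I$ (for $n=0$ the only index is $I=\emptyset$, and $L^{(q)}_{0,\emptyset}=1$). Let $\mathrm{QSym}\subseteq\mathbb{C}[[x_1,x_2,\dots]]$ be the algebra of quasisymmetric functions, i.e. the power series of bounded degree in which, for all $i_1<\dots<i_m$ and all $k_1,\dots,k_m\ge1$, the coefficients of $x_{i_1}^{k_1}\cdots x_{i_m}^{k_m}$ and of $x_1^{k_1}\cdots x_m^{k_m}$ agree. Let $p\ge1$ be an integer and $\rho_p=e^{-i\pi(p-1)/(p+1)}$. A set $I\subseteq\{1,\dots,n-1\}$ is a $p$-extended peak set if $I\cup\{0\}$ does not contain more than $p$ consecutive integers. Let $\mathcal{P}^p$ be the complex linear span of all $L^{(\rho_p)}_{n,I}$ with $n\ge0$ and $I\subseteq\{1,\dots,n-1\}$. **Theorem.** For every integer $p\ge 1$, $\mathcal{P}^p$ is a (unital) subalgebra of $\mathrm{QSym}$;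 in particular it is closed under multiplication. The family of all $L^{(\rho_p)}_{n,I}$ with $n\ge0$ and $I\subseteq\{1,\dots,n-1\}$ a $p$-extended peak set is a basis of the complex vector space $\mathcal{P}^p$. -/

import Mathlib

/-- The totally ordered set `-1 < 1 < -2 < 2 < -3 < 3 < ...` of nonzero integers.  The pair
`(k, false)` stands for `-k` and the pair `(k, true)` stands for `k`. -/
abbrev SignedPos : Type := ℕ+ ×ₗ Bool

namespace SignedPos

/-- The absolute value of an element of `SignedPos`. -/
def abs (z : SignedPos) : ℕ+ := (ofLex z).1

/-- `z` is a positive integer. -/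
def IsPos (z : SignedPos) : Prop := (ofLex z).2 = true

/-- `z` is a negative integer. -/
def IsNeg (z : SignedPos) : Prop := (ofLex z).2 = false

instance (z : SignedPos) : Decidable (IsNeg z) := inferInstanceAs (Decidable (_ = _))

end SignedPos

/-- A labelled weighted poset `([n], <_P, ε)`: an arbitrary strict partial order on the label
set `Fin n` (the labels keep their usual order besides) and positive integer weights. -/
structure LabelledWeightedPoset (n : ℕ) where
  /-- the strict order `<_P` -/
  lt : Fin n → Fin n → Prop
  irrefl : ∀ i, ¬ lt i i
  trans : ∀ i j k, lt i j → lt j k → lt i k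
  /-- the weight function -/
  weight : Fin n → ℕ+

namespace LabelledWeightedPoset

variable {n : ℕ}

/-- Enriched `P`-partitions. -/
def IsEnrichedPartition (P : LabelledWeightedPoset n) (f : Fin n → SignedPos) : Prop :=
  (∀ i j, P.lt i j → i < j → f i < f j ∨ (f i = f j ∧ (f i).IsPos)) ∧
  (∀ i j, P.lt i j → j < i → f i < f j ∨ (f i = f j ∧ (f i).IsNeg))

/-- The exponent vector of the monomial `∏ i, x_{|f i|} ^ ε i`. -/
noncomputable def exponent (P : LabelledWeightedPoset n) (f : Fin n → SignedPos) : ℕ+ →₀ ℕ :=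
  ∑ i, Finsupp.single (f i).abs (P.weight i : ℕ)

/-- Only finitely many maps have a given exponent vector, so that the sums in the definition of
the generating function below are finite sums. -/
theorem finite_exponent_eq (P : LabelledWeightedPoset n) (d : ℕ+ →₀ ℕ) :
    {f : Fin n → SignedPos | P.exponent f = d}.Finite := by
  classical
  let T : Set SignedPos := {z | z.abs ∈ d.support}
  have hT : T.Finite := by
    have : T ⊆ (fun y : ℕ+ × Bool => (toLex y : SignedPos)) ''
        ((d.support : Set ℕ+) ×ˢ (Set.univ : Set Bool)) := by
      intro z hz
      exact ⟨ofLex z, ⟨hz, Set.mem_univ _⟩, rfl⟩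
    exact ((d.support.finite_toSet.prod Set.finite_univ).image _).subset this
  refine (Set.Finite.pi (fun _ : Fin n => hT)).subset ?_
  intro f hf i _
  have hf' : P.exponent f = d := hf
  change (f i).abs ∈ d.support
  rw [Finsupp.mem_support_iff, ← hf', exponent, Finsupp.finsetSum_apply]
  have h1 : (Finsupp.single (f i).abs (P.weight i : ℕ)) (f i).abs ≤
      ∑ j, (Finsupp.single (f j).abs (P.weight j : ℕ)) (f i).abs :=
    Finset.single_le_sum (f := fun j => (Finsupp.single (f j).abs (P.weight j : ℕ)) (f i).abs)
      (fun _ _ => Nat.zero_le _) (Finset.mem_univ i)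
  rw [Finsupp.single_eq_same] at h1
  have := (P.weight i).pos
  omega

/-- The `q`-deformed generating function: the sum over all enriched `P`-partitions `f` of
`∏ i, q ^ [f i < 0] * x_{|f i|} ^ ε i`, given through its coefficients. -/
noncomputable def generatingFunction (q : ℂ) (P : LabelledWeightedPoset n) :
    MvPowerSeries ℕ+ ℂ :=
  fun d => ∑ᶠ f ∈ {f : Fin n → SignedPos | P.IsEnrichedPartition f ∧ P.exponent f = d},
    ∏ i, (if (f i).IsNeg then q else 1)

/-- The chain `π₁ <_π π₂ <_π ... <_π πₙ`, in which the vertex labelled `πᵢ` has weight `αᵢ`. -/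
def chain (π : Equiv.Perm (Fin n)) (α : Fin n → ℕ+) : LabelledWeightedPoset n where
  lt a b := π.symm a < π.symm b
  irrefl _ := lt_irrefl _
  trans _ _ _ := lt_trans
  weight v := α (π.symm v)

end LabelledWeightedPoset

/-- The `q`-universal quasisymmetric function of a permutation and a composition. -/
noncomputable def qUniversal (q : ℂ) {n : ℕ} (π : Equiv.Perm (Fin n)) (α : Fin n → ℕ+) :
    MvPowerSeries ℕ+ ℂ :=
  (LabelledWeightedPoset.chain π α).generatingFunction q

/-- The `q`-fundamental quasisymmetric function of a permutation. -/
noncomputable def qFundamentalPerm (q : ℂ) {n : ℕ} (π : Equiv.Perm (Fin n)) :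
    MvPowerSeries ℕ+ ℂ :=
  qUniversal q π (fun _ => 1)

/-- The descent set of a permutation, as a subset of `{1, ..., n-1}`: the `i`-th entry of the
word of `π` is `π ⟨i - 1, _⟩`. -/
def descentSet {n : ℕ} (π : Equiv.Perm (Fin n)) : Finset ℕ :=
  (Finset.Icc 1 (n - 1)).filter
    (fun i => ∃ h : i < n, π ⟨i, h⟩ < π ⟨i - 1, lt_of_le_of_lt (Nat.sub_le i 1) h⟩)

/-- Membership in the descent set, with the position shifted by one. -/
theorem succ_mem_descentSet {n : ℕ} (π : Equiv.Perm (Fin n)) (i : ℕ) (h : i + 1 < n) :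
    i + 1 ∈ descentSet π ↔ π ⟨i + 1, h⟩ < π ⟨i, (Nat.lt_succ_self i).trans h⟩ := by
  simp only [descentSet, Finset.mem_filter, Finset.mem_Icc, Nat.add_sub_cancel]
  constructor
  · rintro ⟨_, _, h2⟩
    exact h2
  · intro h2
    exact ⟨⟨by omega, by omega⟩, h, h2⟩

/-- Every subset of `{1, ..., n-1}` is the descent set of some permutation. -/
theorem exists_perm_descentSet_eq (n : ℕ) (I : Finset ℕ) (hI : I ⊆ Finset.Icc 1 (n - 1)) :
    ∃ π : Equiv.Perm (Fin n), descentSet π = I := by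
  classical
  let c : ℕ → ℕ := fun i => (I.filter (fun j => i < j)).card
  let key : Fin n → ℕ ×ₗ ℕ := fun i => toLex (c i, (i : ℕ))
  have hinj : Function.Injective key := by
    intro a b hab
    have h2 : (a : ℕ) = b := congrArg (fun z : ℕ ×ₗ ℕ => (ofLex z).2) hab
    exact Fin.ext h2
  have hmono : StrictMono (key ∘ Tuple.sort key) :=
    (Tuple.monotone_sort key).strictMono_of_injective
      (hinj.comp (Tuple.sort key).injective)
  let π : Equiv.Perm (Fin n) := (Tuple.sort key).symm
  have hπ : ∀ a b : Fin n, π a < π b ↔ key a < key b := by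
    intro a b
    rw [← hmono.lt_iff_lt]
    simp [π]
  refine ⟨π, ?_⟩
  have hstep : ∀ i : ℕ, c i = c (i + 1) + (if i + 1 ∈ I then 1 else 0) := by
    intro i
    have : I.filter (fun j => i < j) =
        I.filter (fun j => i + 1 < j) ∪ I.filter (fun j => j = i + 1) := by
      ext j
      simp only [Finset.mem_filter, Finset.mem_union]
      constructor
      · rintro ⟨h1, h2⟩
        rcases eq_or_lt_of_le (Nat.succ_le_of_lt h2) with h | h
        · exact Or.inr ⟨h1, h.symm⟩
        · exact Or.inl ⟨h1, h⟩
      · rintro (⟨h1, h2⟩ | ⟨h1, h2⟩)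
        · exact ⟨h1, by omega⟩
        · exact ⟨h1, by omega⟩
    change (I.filter (fun j => i < j)).card = (I.filter (fun j => i + 1 < j)).card + _
    rw [this, Finset.card_union_of_disjoint, Finset.filter_eq']
    · split_ifs <;> simp
    · rw [Finset.disjoint_left]
      intro j h1 h2
      simp only [Finset.mem_filter] at h1 h2
      omega
  ext i
  by_cases hi : i ∈ Finset.Icc 1 (n - 1)
  · rw [Finset.mem_Icc] at hi
    obtain ⟨k, rfl⟩ : ∃ k, i = k + 1 := ⟨i - 1, by omega⟩
    have hk : k + 1 < n := by omega
    rw [succ_mem_descentSet π k hk, hπ]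
    change toLex (c (k + 1), k + 1) < toLex (c k, k) ↔ _
    rw [Prod.Lex.toLex_lt_toLex, hstep k]
    split_ifs with h
    · simp [h]
    · simp [h]
  · constructor
    · intro h
      exact absurd (Finset.mem_filter.1 h).1 hi
    · intro h
      exact absurd (hI h) hi

/-- The `q`-fundamental quasisymmetric function indexed by a subset `I` of `{1, ..., n-1}`: the
one of any permutation with descent set `I`. -/
noncomputable def qFundamental (q : ℂ) (n : ℕ) (I : {I : Finset ℕ // I ⊆ Finset.Icc 1 (n - 1)}) :
    MvPowerSeries ℕ+ ℂ :=
  qFundamentalPerm q (exists_perm_descentSet_eq n I.1 I.2).choose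

/-- Enriched partitions of a chain, read along the chain, in terms of the descent set only. -/
theorem chain_isEnrichedPartition_iff {n : ℕ} (π : Equiv.Perm (Fin n)) (α : Fin n → ℕ+)
    (g : Fin n → SignedPos) :
    (LabelledWeightedPoset.chain π α).IsEnrichedPartition (g ∘ π.symm) ↔
      ∀ (i : ℕ) (h : i + 1 < n),
        g ⟨i, (Nat.lt_succ_self i).trans h⟩ < g ⟨i + 1, h⟩ ∨
        (g ⟨i, (Nat.lt_succ_self i).trans h⟩ = g ⟨i + 1, h⟩ ∧
          ((g ⟨i + 1, h⟩).IsNeg ↔ i + 1 ∈ descentSet π)) := by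
  have hnp : ∀ z : SignedPos, z.IsPos ↔ ¬ z.IsNeg := by
    intro z
    simp [SignedPos.IsPos, SignedPos.IsNeg]
  constructor
  · rintro ⟨h1, h2⟩ i h
    set a : Fin n := ⟨i, (Nat.lt_succ_self i).trans h⟩ with ha
    set b : Fin n := ⟨i + 1, h⟩ with hb
    have hab : a < b := Nat.lt_succ_self i
    have hl : (LabelledWeightedPoset.chain π α).lt (π a) (π b) := by
      simpa [LabelledWeightedPoset.chain] using hab
    rw [succ_mem_descentSet π i h]
    rcases lt_trichotomy (π a) (π b) with h3 | h3 | h3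
    · have := h1 _ _ hl h3
      simp only [Function.comp, Equiv.symm_apply_apply, hnp] at this
      rcases this with h4 | ⟨h4, h5⟩
      · exact Or.inl h4
      · refine Or.inr ⟨h4, ?_⟩
        rw [← h4]
        exact ⟨fun h => absurd h h5, fun h => absurd h (not_lt.2 h3.le)⟩
    · exact absurd (π.injective h3) hab.ne
    · have := h2 _ _ hl h3
      simp only [Function.comp, Equiv.symm_apply_apply] at this
      rcases this with h4 | ⟨h4, h5⟩
      · exact Or.inl h4
      · refine Or.inr ⟨h4, ?_⟩
        rw [← h4]
        exact ⟨fun _ => h3, fun _ => h5⟩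
  · intro H
    -- along a chain: strict growth, or equality with a monotone stretch of `π`
    have key : ∀ (k i : ℕ) (h : i + (k + 1) < n),
        g ⟨i, (Nat.lt_add_of_pos_right (Nat.succ_pos k)).trans h⟩ < g ⟨i + (k + 1), h⟩ ∨
        (g ⟨i, (Nat.lt_add_of_pos_right (Nat.succ_pos k)).trans h⟩ = g ⟨i + (k + 1), h⟩ ∧
          (((g ⟨i + (k + 1), h⟩).IsNeg ∧
            π ⟨i + (k + 1), h⟩ < π ⟨i, (Nat.lt_add_of_pos_right (Nat.succ_pos k)).trans h⟩) ∨
           (¬ (g ⟨i + (k + 1), h⟩).IsNeg ∧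
            π ⟨i, (Nat.lt_add_of_pos_right (Nat.succ_pos k)).trans h⟩ < π ⟨i + (k + 1), h⟩))) := by
      have step : ∀ (i : ℕ) (h : i + 1 < n),
          g ⟨i, (Nat.lt_succ_self i).trans h⟩ < g ⟨i + 1, h⟩ ∨
          (g ⟨i, (Nat.lt_succ_self i).trans h⟩ = g ⟨i + 1, h⟩ ∧
          (((g ⟨i + 1, h⟩).IsNeg ∧ π ⟨i + 1, h⟩ < π ⟨i, (Nat.lt_succ_self i).trans h⟩) ∨
           (¬ (g ⟨i + 1, h⟩).IsNeg ∧ π ⟨i, (Nat.lt_succ_self i).trans h⟩ < π ⟨i + 1, h⟩))) := by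
        intro i h
        rcases H i h with h1 | ⟨h1, h2⟩
        · exact Or.inl h1
        · refine Or.inr ⟨h1, ?_⟩
          rw [succ_mem_descentSet π i h] at h2
          by_cases h3 : (g ⟨i + 1, h⟩).IsNeg
          · exact Or.inl ⟨h3, h2.1 h3⟩
          · refine Or.inr ⟨h3, lt_of_le_of_ne (not_lt.1 (fun h4 => h3 (h2.2 h4))) ?_⟩
            intro h5
            have := congrArg Fin.val (π.injective h5)
            simp at this
      intro k
      induction k with
      | zero => exact step
      | succ k ih =>
        intro i h
        have h0 : i + (k + 1) < n := by omega
        have e1 := ih i h0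
        have e2 := step (i + (k + 1)) h
        change _ < g ⟨i + (k + 1) + 1, h⟩ ∨ (_ = g ⟨i + (k + 1) + 1, h⟩ ∧
          (((g ⟨i + (k + 1) + 1, h⟩).IsNeg ∧ π ⟨i + (k + 1) + 1, h⟩ < _) ∨
            (¬ (g ⟨i + (k + 1) + 1, h⟩).IsNeg ∧ _ < π ⟨i + (k + 1) + 1, h⟩)))
        rcases e1 with e1 | ⟨e1, e1'⟩
        · rcases e2 with e2 | ⟨e2, _⟩
          · exact Or.inl (e1.trans e2)
          · exact Or.inl (e2 ▸ e1)
        · rcases e2 with e2 | ⟨e2, e2'⟩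
          · exact Or.inl (e1 ▸ e2)
          · refine Or.inr ⟨e1.trans e2, ?_⟩
            rw [e2] at e1'
            rcases e1' with ⟨a1, a2⟩ | ⟨a1, a2⟩
            · rcases e2' with ⟨b1, b2⟩ | ⟨b1, b2⟩
              · exact Or.inl ⟨b1, b2.trans a2⟩
              · exact absurd a1 b1
            · rcases e2' with ⟨b1, b2⟩ | ⟨b1, b2⟩
              · exact absurd b1 a1
              · exact Or.inr ⟨b1, a2.trans b2⟩
    have key' : ∀ a b : Fin n, a < b → g a < g b ∨
        (g a = g b ∧ (((g b).IsNeg ∧ π b < π a) ∨ (¬ (g b).IsNeg ∧ π a < π b))) := by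
      rintro ⟨a, ha⟩ ⟨b, hb⟩ hab
      have hab' : a < b := hab
      obtain ⟨k, rfl⟩ : ∃ k, b = a + (k + 1) := ⟨b - a - 1, by omega⟩
      exact key k a hb
    constructor
    · intro u v huv h
      rcases key' (π.symm u) (π.symm v) huv with h1 | ⟨h1, h2⟩
      · exact Or.inl h1
      · simp only [Equiv.apply_symm_apply] at h2
        refine Or.inr ⟨h1, ?_⟩
        rw [hnp]
        simp only [Function.comp, h1]
        rcases h2 with ⟨_, h3⟩ | ⟨h3, _⟩
        · exact absurd h3 (not_lt.2 h.le)
        · exact h3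
    · intro u v huv h
      rcases key' (π.symm u) (π.symm v) huv with h1 | ⟨h1, h2⟩
      · exact Or.inl h1
      · simp only [Equiv.apply_symm_apply] at h2
        refine Or.inr ⟨h1, ?_⟩
        simp only [Function.comp, h1]
        rcases h2 with ⟨h3, _⟩ | ⟨_, h3⟩
        · exact h3
        · exact absurd h3 (not_lt.2 h.le)

/-- The `q`-fundamental of a permutation depends only on its descent set. -/
theorem qFundamentalPerm_congr (q : ℂ) {n : ℕ} (π σ : Equiv.Perm (Fin n))
    (h : descentSet π = descentSet σ) : qFundamentalPerm q π = qFundamentalPerm q σ := by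
  have main : ∀ τ : Equiv.Perm (Fin n), qFundamentalPerm q τ = fun d =>
      ∑ᶠ g ∈ {g : Fin n → SignedPos | (∀ (i : ℕ) (h : i + 1 < n),
        g ⟨i, (Nat.lt_succ_self i).trans h⟩ < g ⟨i + 1, h⟩ ∨
        (g ⟨i, (Nat.lt_succ_self i).trans h⟩ = g ⟨i + 1, h⟩ ∧
          ((g ⟨i + 1, h⟩).IsNeg ↔ i + 1 ∈ descentSet τ))) ∧
          ∑ i, Finsupp.single (g i).abs 1 = d},
      ∏ i, (if (g i).IsNeg then q else 1) := by
    intro τ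
    funext d
    refine finsum_mem_eq_of_bijOn (fun f => f ∘ τ) ⟨?_, ?_, ?_⟩ ?_
    · rintro f ⟨h1, h2⟩
      have hf : (f ∘ τ) ∘ τ.symm = f := by funext x; simp
      refine ⟨(chain_isEnrichedPartition_iff τ (fun _ => 1) (f ∘ τ)).1 (by rwa [hf]), ?_⟩
      rw [← h2]
      exact Equiv.sum_comp τ (fun i => Finsupp.single (f i).abs 1)
    · intro f _ f' _ hff
      exact τ.surjective.injective_comp_right hff
    · rintro g ⟨h1, h2⟩
      refine ⟨g ∘ τ.symm, ⟨(chain_isEnrichedPartition_iff τ (fun _ => 1) g).2 h1, ?_⟩, ?_⟩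
      · rw [← h2]
        exact Equiv.sum_comp τ.symm (fun i => Finsupp.single (g i).abs 1)
      · funext x; simp
    · intro f _
      exact (Equiv.prod_comp τ (fun i => if (f i).IsNeg then q else 1)).symm
  rw [main π, main σ, h]

/-- The choice of a permutation in the definition of `qFundamental` does not matter. -/
theorem qFundamentalPerm_eq_qFundamental (q : ℂ) {n : ℕ} (π : Equiv.Perm (Fin n)) :
    qFundamentalPerm q π = qFundamental q n ⟨descentSet π, Finset.filter_subset _ _⟩ :=
  qFundamentalPerm_congr q _ _
    (exists_perm_descentSet_eq n (descentSet π) (Finset.filter_subset _ _)).choose_spec.symm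

/-- Quasisymmetric power series: for `i₁ < i₂ < ... < i_m`, the coefficients of
`x₁ ^ k₁ * ... * x_m ^ k_m` and of `x_{i₁} ^ k₁ * ... * x_{i_m} ^ k_m` agree
(the `m` positive exponents are listed by `k`). -/
def IsQuasisymmetric (F : MvPowerSeries ℕ+ ℂ) : Prop :=
  ∀ (m : ℕ) (k : Fin m → ℕ+) (i : Fin m → ℕ+), StrictMono i →
    MvPowerSeries.coeff (∑ j, Finsupp.single (i j) (k j : ℕ)) F =
      MvPowerSeries.coeff (∑ j : Fin m, Finsupp.single (Nat.succPNat j) (k j : ℕ)) F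

/-- The quasisymmetric functions: quasisymmetric power series of bounded degree. -/
def QSym : Set (MvPowerSeries ℕ+ ℂ) :=
  {F | IsQuasisymmetric F ∧ ∃ N : ℕ, ∀ d : ℕ+ →₀ ℕ, MvPowerSeries.coeff d F ≠ 0 → d.degree ≤ N}

/-- `I` is a `p`-extended peak set: `I ∪ {0}` does not contain `p + 1` consecutive integers. -/
def IsExtendedPeakSet (p : ℕ) (I : Finset ℕ) : Prop :=
  ∀ a : ℕ, ¬ Finset.Icc a (a + p) ⊆ insert 0 I

/-- `ρ_p = exp (-iπ (p - 1) / (p + 1))`. -/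
noncomputable def rho (p : ℕ) : ℂ :=
  Complex.exp (-(Complex.I * Real.pi * ((p : ℂ) - 1) / ((p : ℂ) + 1)))

/-- All pairs of some `n ≥ 0` and a subset `I` of `{1, ..., n-1}`. -/
abbrev SetIndex : Type := Σ n : ℕ, {I : Finset ℕ // I ⊆ Finset.Icc 1 (n - 1)}

/-- The `p`-extended peak quasisymmetric functions. -/
noncomputable def extendedPeakFunction (p : ℕ) (s : SetIndex) : MvPowerSeries ℕ+ ℂ :=
  qFundamental (rho p) s.1 s.2

/-- The linear span of all the `p`-extended peak quasisymmetric functions. -/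
noncomputable def extendedPeakSpan (p : ℕ) : Submodule ℂ (MvPowerSeries ℕ+ ℂ) :=
  Submodule.span ℂ (Set.range (extendedPeakFunction p))

/-! Closure under multiplication holds for every `q` and is P-partition theory. Each map is sorted
by exactly one chain, so a generating function with unit weights is the sum of the fundamentals of
the linear extensions (`generatingFunction_eq_sum_linearExtension`). A product of two generating
functions is that of the disjoint union (`generatingFunction_mul`).

For the basis, the coefficient of `L_I` at a weakly increasing word depends only on the set `J` of
positions where the word jumps, and is a weighted count of sign sequences. Pass to the alternating
sums `N_S = ∑_{I ⊆ S} (-1)^{|S \ I|} L_I`, so that `L_I = ∑_{S ⊆ I} N_S`. Inside a run of `S`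
without jumps all signs agree, and the coefficients of `N_S` factor (`signSum_alternatingStep`): up
to sign they are products of terms `1 - (-q)^g`, with `g` the distance from a position (`0` or a
jump) to the next larger non-element of `S`; a jump in `S` gives `0`.

At `q = ρ_p`, `-q` is a primitive `(p+1)`-st root of unity, so `g = p + 1` kills a term and other
exponents matter only mod `p + 1`. If `S` is not an extended peak set, take its last run of `p + 1`
consecutive integers in `S ∪ {0}`, starting at `x`: then `N_S = 0` if `x = 0`, and `N_S = -N_{S \
x}` otherwise. Hence the `N_S` of extended peak sets span. They are independent because each has a
largest jump set with nonzero coefficient, from which `S` can be recovered. Extended peak sets are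
closed under taking subsets, so a unitriangular change of family carries both facts to the `L_I`. -/

/-! ### Sums over sign sequences by transfer kernels -/

/-- The weight `q` of a negative sign `false` and `1` of a positive sign `true`. -/
noncomputable def signWeight (q : ℂ) (b : Bool) : ℂ := if b then 1 else q

/-- The sum over all sign sequences, weighted by the transfer kernels `T 1, ..., T m`. -/
noncomputable def signSum (q : ℂ) (m : ℕ) (T : ℕ → Bool → Bool → ℂ) : ℂ :=
  ∑ s : Fin (m + 1) → Bool,
    (∏ i, signWeight q (s i)) * ∏ i : Fin m, T (i + 1) (s i.castSucc) (s i.succ)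

/-- The sum over all continuations by `m` signs of a sign sequence ending at position `a`
with the sign `b`. -/
noncomputable def tailSum (q : ℂ) (T : ℕ → Bool → Bool → ℂ) : ℕ → ℕ → Bool → ℂ
  | 0, _, _ => 1
  | m + 1, a, b => ∑ c, signWeight q c * T (a + 1) b c * tailSum q T m (a + 1) c

theorem sum_cons_eq_tailSum (q : ℂ) (T : ℕ → Bool → Bool → ℂ) (m a : ℕ) (b : Bool) :
    ∑ s : Fin m → Bool, (∏ i, signWeight q (s i)) *
      ∏ i : Fin m, T (a + i + 1) ((Fin.cons b s : Fin (m + 1) → Bool) i.castSucc) (s i) =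
      tailSum q T m a b := by
  induction m generalizing a b with
  | zero => simp [tailSum]
  | succ m ih =>
    rw [tailSum, ← (Fin.consEquiv (fun _ : Fin (m + 1) => Bool)).sum_comp,
      Fintype.sum_prod_type]
    refine Finset.sum_congr rfl fun c _ => ?_
    rw [← ih, Finset.mul_sum]
    refine Finset.sum_congr rfl fun s _ => ?_
    simp only [Fin.consEquiv, Equiv.coe_fn_mk, Fin.prod_univ_succ, Fin.cons_zero, Fin.cons_succ,
      Fin.castSucc_zero, Fin.val_zero, Fin.val_succ, ← Fin.succ_castSucc, add_zero]
    simp only [show ∀ i : Fin m, a + (↑i + 1) + 1 = a + 1 + ↑i + 1 from fun i => by ring]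
    ring

theorem signSum_eq_tailSum (q : ℂ) (T : ℕ → Bool → Bool → ℂ) (m : ℕ) :
    signSum q m T = ∑ b, signWeight q b * tailSum q T m 0 b := by
  rw [signSum, ← (Fin.consEquiv (fun _ : Fin (m + 1) => Bool)).sum_comp, Fintype.sum_prod_type]
  refine Finset.sum_congr rfl fun c _ => ?_
  rw [← sum_cons_eq_tailSum, Finset.mul_sum]
  refine Finset.sum_congr rfl fun s _ => ?_
  simp only [Fin.consEquiv, Equiv.coe_fn_mk, Fin.prod_univ_succ, Fin.cons_zero, Fin.cons_succ,
    zero_add]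
  ring

/-! ### Fundamental kernels and inclusion–exclusion over subsets -/

/-- The transfer kernel at an ascent, for words with jump set `J`. -/
def ascentStep (J : Finset ℕ) (i : ℕ) (_ c : Bool) : ℂ :=
  if i ∈ J then 1 else if c then 1 else 0

/-- The transfer kernel at a descent, for words with jump set `J`. -/
def descentStep (J : Finset ℕ) (i : ℕ) (b _ : Bool) : ℂ :=
  if i ∈ J then 1 else if b then 0 else 1

/-- The transfer kernels of the fundamental function with descent set `I`. -/
def fundamentalStep (I J : Finset ℕ) (i : ℕ) (b c : Bool) : ℂ :=
  if i ∈ I then descentStep J i b c else ascentStep J i b c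

/-- The transfer kernels of the alternating sum of the fundamental functions over the
subsets of `S`. -/
def alternatingStep (S J : Finset ℕ) (i : ℕ) (b c : Bool) : ℂ :=
  if i ∈ S then descentStep J i b c - ascentStep J i b c else ascentStep J i b c

/-- Write `a i = (a i - b i) + b i` at the indices of `I` and expand. -/
theorem prod_ite_add_eq_sum_powerset {ι : Type*} [DecidableEq ι] (X I : Finset ι) (hI : I ⊆ X)
    (a b : ι → ℂ) :
    ∏ i ∈ X, (if i ∈ I then a i else b i) =
      ∑ S ∈ I.powerset, ∏ i ∈ X, (if i ∈ S then a i - b i else b i) := by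
  have h : ∀ S ⊆ I, ∀ f : ι → ℂ, ∏ i ∈ X, (if i ∈ S then f i else b i) =
      (∏ i ∈ S, f i) * (∏ i ∈ I \ S, b i) * ∏ i ∈ X \ I, b i := by
    intro S hS f
    rw [Finset.prod_ite, Finset.filter_mem_eq_inter, Finset.inter_eq_right.2 (hS.trans hI),
      Finset.filter_notMem_eq_sdiff, mul_assoc]
    congr 1
    rw [← Finset.prod_union (Finset.disjoint_left.2 fun x hx hx' => by simp_all)]
    congr 1
    ext x
    have := @hS x
    have := @hI x
    simp only [Finset.mem_sdiff, Finset.mem_union]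
    tauto
  rw [h I subset_rfl, Finset.sdiff_self, Finset.prod_empty, mul_one,
    Finset.sum_congr rfl fun S hS => h S (Finset.mem_powerset.1 hS) fun i => a i - b i,
    ← Finset.sum_mul, ← Finset.prod_add]
  simp

/-- Reindexing by natural numbers lets the subset expansion apply. `Fin.ofNat` never wraps around
here, since `i ≤ m`. -/
theorem prod_fin_eq_prod_Icc (m : ℕ) (s : Fin (m + 1) → Bool) (T : ℕ → Bool → Bool → ℂ) :
    ∏ i : Fin m, T (i + 1) (s i.castSucc) (s i.succ) =
      ∏ i ∈ Finset.Icc 1 m, T i (s (Fin.ofNat (m + 1) (i - 1))) (s (Fin.ofNat (m + 1) i)) := by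
  refine Finset.prod_bij (fun i _ => (i : ℕ) + 1) ?_ ?_ ?_ ?_
  · intro i _
    simp
  · intro i _ j _ h
    exact Fin.ext (by simpa using h)
  · intro i hi
    rw [Finset.mem_Icc] at hi
    exact ⟨⟨i - 1, by omega⟩, Finset.mem_univ _, by simp; omega⟩
  · intro i _
    congr 2
    · ext
      have := i.2
      simp
    · ext
      have := i.2
      simp [Nat.mod_eq_of_lt (show (i : ℕ) + 1 < m + 1 by omega)]

theorem signSum_fundamentalStep (q : ℂ) (m : ℕ) (I J : Finset ℕ) (hI : I ⊆ Finset.Icc 1 m) :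
    signSum q m (fundamentalStep I J) =
      ∑ S ∈ I.powerset, signSum q m (alternatingStep S J) := by
  simp only [signSum]
  rw [Finset.sum_comm]
  refine Finset.sum_congr rfl fun s _ => ?_
  rw [← Finset.mul_sum]
  congr 1
  rw [prod_fin_eq_prod_Icc m s (fundamentalStep I J),
    Finset.sum_congr rfl fun S _ => prod_fin_eq_prod_Icc m s (alternatingStep S J)]
  exact prod_ite_add_eq_sum_powerset _ _ hI
    (fun i => descentStep J i (s (Fin.ofNat (m + 1) (i - 1))) (s (Fin.ofNat (m + 1) i)))
    (fun i => ascentStep J i (s (Fin.ofNat (m + 1) (i - 1))) (s (Fin.ofNat (m + 1) i)))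

/-! ### Runs of a set and the product formula for the alternating sums -/

/-- The distance from `t` to the next larger number that does not belong to `S`. -/
noncomputable def gap (S : Finset ℕ) (t : ℕ) : ℕ :=
  sInf {k | t + 1 + k ∉ S} + 1

theorem exists_add_notMem (S : Finset ℕ) (t : ℕ) : {k | t + 1 + k ∉ S}.Nonempty :=
  ⟨S.sup id, fun h => by 
    have h' : t + 1 + S.sup id ≤ S.sup id := Finset.le_sup (f := id) h
    omega⟩

theorem gap_eq_iff (S : Finset ℕ) (t k : ℕ) :
    gap S t = k + 1 ↔ (∀ i < k, t + 1 + i ∈ S) ∧ t + 1 + k ∉ S := by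
  have h0 : t + 1 + sInf {k | t + 1 + k ∉ S} ∉ S := Nat.sInf_mem (exists_add_notMem S t)
  have h1 : ∀ i < sInf {k | t + 1 + k ∉ S}, t + 1 + i ∈ S := fun i hi => by
    simpa using Nat.notMem_of_lt_sInf hi
  rw [gap, Nat.add_right_cancel_iff]
  constructor
  · rintro rfl
    exact ⟨h1, h0⟩
  · rintro ⟨h2, h3⟩
    rcases lt_trichotomy (sInf {k | t + 1 + k ∉ S}) k with h | h | h
    · exact absurd (h2 _ h) h0
    · exact h
    · exact absurd (h1 _ h) h3

theorem gap_pos (S : Finset ℕ) (t : ℕ) : 0 < gap S t := Nat.succ_pos _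

theorem gap_spec (S : Finset ℕ) (t : ℕ) :
    (∀ i, i + 1 < gap S t → t + 1 + i ∈ S) ∧ t + gap S t ∉ S := by
  obtain ⟨k, hk⟩ : ∃ k, gap S t = k + 1 := ⟨_, rfl⟩
  have := (gap_eq_iff S t k).1 hk
  rw [hk]
  exact ⟨fun i hi => this.1 i (by omega), by convert this.2 using 2; ring⟩

theorem gap_of_notMem {S : Finset ℕ} {t : ℕ} (h : t + 1 ∉ S) : gap S t = 1 :=
  (gap_eq_iff S t 0).2 ⟨by simp, by simpa using h⟩

theorem gap_of_mem {S : Finset ℕ} {t : ℕ} (h : t + 1 ∈ S) : gap S t = gap S (t + 1) + 1 := by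
  obtain ⟨k, hk⟩ : ∃ k, gap S (t + 1) = k + 1 := ⟨_, rfl⟩
  rw [hk, gap_eq_iff]
  obtain ⟨h1, h2⟩ := (gap_eq_iff S (t + 1) k).1 hk
  constructor
  · rintro (_ | i) hi
    · simpa using h
    · have := h1 i (by omega)
      rwa [show t + 1 + (i + 1) = t + 1 + 1 + i by ring]
  · rwa [show t + 1 + (k + 1) = t + 1 + 1 + k by ring]

/-- The factor contributed by the position `t` to the coefficients of the alternating sums. -/
noncomputable def positionFactor (q : ℂ) (S J : Finset ℕ) (t : ℕ) : ℂ :=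
  if t ∈ S then (if t ∈ J then 0 else -1) else (if t ∈ J then 1 - (-q) ^ gap S t else 1)

/-- Induction on the length. At a non-jump in `S` the sign must repeat, with total weight `-1` for a
plus and `q` for a minus, so each such step multiplies the ratio minus/plus by `-q`; at a jump in
`S` the kernel is `0`. Outside `S` the next sign does not depend on the current one: it is a plus at
a non-jump and free at a jump, where the two signs add up to `1 - (-q) ^ gap`. The hypothesis on `a
+ m + 1` stops the last run at the end of the word. -/
theorem tailSum_alternatingStep (q : ℂ) (S J : Finset ℕ) (m a : ℕ) (h : a + m + 1 ∉ S) :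
    tailSum q (alternatingStep S J) m a true = ∏ t ∈ Finset.Ioc a (a + m), positionFactor q S J t ∧
    tailSum q (alternatingStep S J) m a false =
      (-q) ^ (gap S a - 1) * ∏ t ∈ Finset.Ioc a (a + m), positionFactor q S J t := by
  induction m generalizing a with
  | zero => simp [tailSum, gap_of_notMem (by simpa using h : a + 1 ∉ S)]
  | succ m ih =>
    obtain ⟨h1, h2⟩ := ih (a + 1) (by rwa [show a + 1 + m + 1 = a + (m + 1) + 1 by ring])
    have e : Finset.Ioc a (a + (m + 1)) = insert (a + 1) (Finset.Ioc (a + 1) (a + 1 + m)) := by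
      ext x
      simp only [Finset.mem_Ioc, Finset.mem_insert]
      omega
    rw [e, Finset.prod_insert (by simp)]
    simp only [tailSum, Fintype.sum_bool, h1, h2]
    generalize ∏ t ∈ Finset.Ioc (a + 1) (a + 1 + m), positionFactor q S J t = P
    obtain ⟨k, hk⟩ : ∃ k, gap S (a + 1) = k + 1 := ⟨_, rfl⟩
    by_cases hS : a + 1 ∈ S
    · rw [gap_of_mem hS]
      by_cases hJ : a + 1 ∈ J
      · simp [signWeight, alternatingStep, descentStep, ascentStep, positionFactor, hS, hJ]
      · simp [signWeight, alternatingStep, descentStep, ascentStep, positionFactor, hS, hJ, hk]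
        ring
    · rw [gap_of_notMem hS]
      by_cases hJ : a + 1 ∈ J
      · simp [signWeight, alternatingStep, ascentStep, positionFactor, hS, hJ, hk]
        ring
      · simp [signWeight, alternatingStep, ascentStep, positionFactor, hS, hJ]

/-- The sign of the first letter is free, so position `0` behaves like a jump outside `S`. -/
theorem signSum_alternatingStep (q : ℂ) (S J : Finset ℕ) (m : ℕ) (h : S ⊆ Finset.Icc 1 m) :
    signSum q m (alternatingStep S J) =
      (1 - (-q) ^ gap S 0) * ∏ t ∈ Finset.Icc 1 m, positionFactor q S J t := by
  have hm : 0 + m + 1 ∉ S := fun hm => by have := h hm; simp at this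
  obtain ⟨h1, h2⟩ := tailSum_alternatingStep q S J m 0 hm
  obtain ⟨k, hk⟩ : ∃ k, gap S 0 = k + 1 := ⟨_, rfl⟩
  have e : Finset.Icc 1 m = Finset.Ioc 0 (0 + m) := by
    ext x
    simp only [Finset.mem_Icc, Finset.mem_Ioc]
    omega
  rw [signSum_eq_tailSum, Fintype.sum_bool, h1, h2, hk, e]
  simp only [signWeight, if_true, Nat.add_sub_cancel]
  simp
  ring

/-! ### Relations when `-q` is a primitive root of unity -/

theorem signSum_alternatingStep_eq_zero {q : ℂ} {p m : ℕ} {S : Finset ℕ} (J : Finset ℕ)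
    (hq : IsPrimitiveRoot (-q) (p + 1)) (hS : S ⊆ Finset.Icc 1 m) (h : gap S 0 = p + 1) :
    signSum q m (alternatingStep S J) = 0 := by
  rw [signSum_alternatingStep q S J m hS, h, hq.pow_eq_one, sub_self, zero_mul]

theorem gap_erase_of_le {S : Finset ℕ} {x t : ℕ} (h : x ≤ t) : gap (S.erase x) t = gap S t := by
  obtain ⟨k, hk⟩ : ∃ k, gap S t = k + 1 := ⟨_, rfl⟩
  rw [hk, gap_eq_iff]
  obtain ⟨h1, h2⟩ := (gap_eq_iff S t k).1 hk
  exact ⟨fun i hi => Finset.mem_erase.2 ⟨by omega, h1 i hi⟩,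
    fun h3 => h2 (Finset.mem_of_mem_erase h3)⟩

/-- If the run after `t` reaches `x`, erasing `x` shortens the gap by exactly `gap S x = p + 1`;
otherwise the gap is unchanged. -/
theorem pow_gap_erase {z : ℂ} {p : ℕ} {S : Finset ℕ} {x : ℕ} (hz : z ^ (p + 1) = 1)
    (hx : gap S x = p + 1) (hxS : x ∈ S) (t : ℕ) :
    z ^ gap (S.erase x) t = z ^ gap S t := by
  rcases le_or_gt x t with h | h
  · rw [gap_erase_of_le h]
  · obtain ⟨k, rfl⟩ : ∃ k, x = t + 1 + k := ⟨x - (t + 1), by omega⟩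
    clear h
    induction k generalizing t with
    | zero =>
      rw [add_zero] at hx hxS ⊢
      rw [gap_of_mem hxS, gap_of_notMem (S := S.erase (t + 1)) (by simp), hx, pow_succ z (p + 1), hz,
        one_mul, pow_one]
    | succ k ih =>
      have e : t + 1 + (k + 1) = t + 1 + 1 + k := by ring
      rw [e] at hx hxS ⊢
      by_cases h : t + 1 ∈ S
      · rw [gap_of_mem h, gap_of_mem (Finset.mem_erase.2 ⟨by omega, h⟩), pow_succ, pow_succ,
          ih (t + 1) hx hxS]
      · rw [gap_of_notMem h, gap_of_notMem (fun h' => h (Finset.mem_of_mem_erase h'))]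

/-- Only the factor at `x` changes. With `x` in `S` it is `0` at a jump and `-1` otherwise; without
`x` it is `1 - (-q) ^ (p + 1) = 0` and `1`. -/
theorem signSum_alternatingStep_erase {q : ℂ} {p m : ℕ} {S : Finset ℕ} {x : ℕ} (J : Finset ℕ)
    (hq : IsPrimitiveRoot (-q) (p + 1)) (hS : S ⊆ Finset.Icc 1 m) (h : gap S x = p + 1)
    (hx : x ∈ S) :
    signSum q m (alternatingStep S J) = -signSum q m (alternatingStep (S.erase x) J) := by
  rw [signSum_alternatingStep q S J m hS,
    signSum_alternatingStep q _ J m ((Finset.erase_subset _ _).trans hS),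
    pow_gap_erase hq.pow_eq_one h hx,
    ← Finset.mul_prod_erase _ _ (hS hx), ← Finset.mul_prod_erase (Finset.Icc 1 m) _ (hS hx)]
  have h1 : positionFactor q S J x = -positionFactor q (S.erase x) J x := by
    simp only [positionFactor, hx, Finset.mem_erase, ne_eq, not_true, false_and, if_true, if_false,
      gap_erase_of_le le_rfl, h, hq.pow_eq_one, sub_self]
    split_ifs <;> simp
  have h2 : ∏ t ∈ (Finset.Icc 1 m).erase x, positionFactor q (S.erase x) J t =
      ∏ t ∈ (Finset.Icc 1 m).erase x, positionFactor q S J t := by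
    refine Finset.prod_congr rfl fun t ht => ?_
    simp only [positionFactor, pow_gap_erase hq.pow_eq_one h hx, Finset.mem_erase,
      (Finset.mem_erase.1 ht).1, ne_eq, not_false_eq_true, true_and]
  rw [h1, h2]
  ring

/-- Take the greatest `x` such that `x, ..., x + p` all lie in `S ∪ {0}`; by maximality `x + p + 1`
is not in `S`. -/
theorem exists_gap_of_not_isExtendedPeakSet {p m : ℕ} (hp : 1 ≤ p) {S : Finset ℕ}
    (hS : S ⊆ Finset.Icc 1 m) (h : ¬ IsExtendedPeakSet p S) :
    ∃ x, gap S x = p + 1 ∧ (x = 0 ∨ x ∈ S) := by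
  simp only [IsExtendedPeakSet, not_forall, not_not] at h
  have hb : ∀ a, Finset.Icc a (a + p) ⊆ insert 0 S → a ≤ m := by
    intro a ha
    have h1 := ha (Finset.right_mem_Icc.2 (Nat.le_add_right a p))
    rw [Finset.mem_insert] at h1
    rcases h1 with h1 | h1
    · omega
    · have := Finset.mem_Icc.1 (hS h1)
      omega
  classical
  obtain ⟨a, ha⟩ := h
  have hx := Nat.findGreatest_spec (P := fun a => Finset.Icc a (a + p) ⊆ insert 0 S) (hb a ha) ha
  have hmax := fun k => Nat.findGreatest_is_greatest
    (P := fun a => Finset.Icc a (a + p) ⊆ insert 0 S) (n := m) (k := k)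
  generalize Nat.findGreatest (fun a => Finset.Icc a (a + p) ⊆ insert 0 S) m = x at hx hmax
  refine ⟨x, (gap_eq_iff _ _ _).2 ⟨fun i hi => ?_, fun h1 => ?_⟩, ?_⟩
  · have := hx (Finset.mem_Icc.2 (by omega : x ≤ x + 1 + i ∧ x + 1 + i ≤ x + p))
    simpa using this
  · have h2 : Finset.Icc (x + 1) (x + 1 + p) ⊆ insert 0 S := by
      intro y hy
      rw [Finset.mem_Icc] at hy
      rcases eq_or_lt_of_le hy.2 with h3 | h3
      · rw [h3]
        exact Finset.mem_insert_of_mem h1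
      · exact hx (Finset.mem_Icc.2 (by omega))
    exact hmax (x + 1) (Nat.lt_succ_self x) (hb _ h2) h2
  · simpa using hx (Finset.left_mem_Icc.2 (Nat.le_add_right x p))

/-! ### Extended peak sets and their leading jump sets -/

theorem IsExtendedPeakSet.mono {p : ℕ} {S T : Finset ℕ} (h : IsExtendedPeakSet p T)
    (hST : S ⊆ T) : IsExtendedPeakSet p S :=
  fun a ha => h a (ha.trans (Finset.insert_subset_insert 0 hST))

theorem IsExtendedPeakSet.gap_le {p : ℕ} {S : Finset ℕ} (h : IsExtendedPeakSet p S) (t : ℕ) :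
    gap S t ≤ p + 1 := by
  by_contra! h1
  refine h (t + 1) fun y hy => Finset.mem_insert_of_mem ?_
  rw [Finset.mem_Icc] at hy
  have := (gap_spec S t).1 (y - (t + 1)) (by omega)
  rwa [Nat.add_sub_cancel' hy.1] at this

theorem IsExtendedPeakSet.gap_ne_of_mem {p : ℕ} {S : Finset ℕ} (h : IsExtendedPeakSet p S) {t : ℕ}
    (ht : t ∈ insert 0 S) : gap S t ≠ p + 1 := by
  intro h1
  refine h t fun y hy => ?_
  rw [Finset.mem_Icc] at hy
  rcases eq_or_lt_of_le hy.1 with h2 | h2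
  · rwa [← h2]
  · have := (gap_spec S t).1 (y - (t + 1)) (by omega)
    rw [Nat.add_sub_cancel' h2] at this
    exact Finset.mem_insert_of_mem this

/-- The largest jump set at which the alternating sum of an extended peak set has a nonzero
coefficient. -/
noncomputable def leadingJumpSet (p m : ℕ) (S : Finset ℕ) : Finset ℕ :=
  (Finset.Icc 1 m).filter fun t => t ∉ S ∧ gap S t ≠ p + 1

/-- For an extended peak set all gaps lie between `1` and `p + 1`, so `1 - (-q) ^ gap` vanishes only
for the gap `p + 1`. That gap does not occur at `0`, and the leading jump set avoids it. -/
theorem signSum_alternatingStep_leadingJumpSet_ne_zero {q : ℂ} {p m : ℕ} {S : Finset ℕ}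
    (hq : IsPrimitiveRoot (-q) (p + 1)) (hS : S ⊆ Finset.Icc 1 m) (h : IsExtendedPeakSet p S) :
    signSum q m (alternatingStep S (leadingJumpSet p m S)) ≠ 0 := by
  have key : ∀ t, gap S t ≠ p + 1 → 1 - (-q) ^ gap S t ≠ 0 := by
    intro t ht
    rw [sub_ne_zero]
    exact (hq.pow_ne_one_of_pos_of_lt (gap_pos S t).ne'
      (lt_of_le_of_ne (h.gap_le t) ht)).symm
  rw [signSum_alternatingStep q S _ m hS]
  refine mul_ne_zero (key 0 (h.gap_ne_of_mem (Finset.mem_insert_self _ _)))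
    (Finset.prod_ne_zero_iff.2 fun t ht => ?_)
  simp only [positionFactor, leadingJumpSet, Finset.mem_filter, ht, true_and]
  split_ifs with h1 h2 h2
  · exact absurd h1 h2.1
  · simp
  · exact key t h2.2
  · exact one_ne_zero

theorem subset_leadingJumpSet {q : ℂ} {p m : ℕ} {S J : Finset ℕ}
    (hq : IsPrimitiveRoot (-q) (p + 1)) (hS : S ⊆ Finset.Icc 1 m) (hJ : J ⊆ Finset.Icc 1 m)
    (h0 : signSum q m (alternatingStep S J) ≠ 0) : J ⊆ leadingJumpSet p m S := by
  rw [signSum_alternatingStep q S _ m hS] at h0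
  intro t ht
  have h1 := Finset.prod_ne_zero_iff.1 (right_ne_zero_of_mul h0) t (hJ ht)
  refine Finset.mem_filter.2 ⟨hJ ht, ?_, ?_⟩
  · intro h2
    simp [positionFactor, ht, h2] at h1
  · intro h2
    by_cases h3 : t ∈ S <;> simp [positionFactor, ht, h2, h3, hq.pow_eq_one] at h1

/-- The set is recovered from right to left, as the gap at `b` depends only on the elements beyond
`b`. If `b` is in `S` but not in `T`, it is missing from both leading sets, so `gap T b = p + 1`.
Then `gap S b = p + 1` too, which is impossible for an element of an extended peak set. -/
theorem leadingJumpSet_injOn {p m : ℕ} {S T : Finset ℕ}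
    (hS : S ⊆ Finset.Icc 1 m) (hT : T ⊆ Finset.Icc 1 m) (hS' : IsExtendedPeakSet p S)
    (hT' : IsExtendedPeakSet p T) (h : leadingJumpSet p m S = leadingJumpSet p m T) : S = T := by
  have step : ∀ {S T : Finset ℕ}, S ⊆ Finset.Icc 1 m → IsExtendedPeakSet p S →
      leadingJumpSet p m S = leadingJumpSet p m T → ∀ b, (∀ c, b < c → (c ∈ S ↔ c ∈ T)) →
      b ∈ S → b ∈ T := by
    intro S T hS hS' h b ih hb
    by_contra hbT
    have h1 : b ∉ leadingJumpSet p m T := by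
      rw [← h]
      exact fun h2 => (Finset.mem_filter.1 h2).2.1 hb
    have h2 : gap T b = p + 1 := by
      by_contra h3
      exact h1 (Finset.mem_filter.2 ⟨hS hb, hbT, h3⟩)
    refine hS'.gap_ne_of_mem (Finset.mem_insert_of_mem hb) ?_
    rw [gap_eq_iff] at h2 ⊢
    exact ⟨fun i hi => (ih _ (by omega)).2 (h2.1 i hi), fun h3 => h2.2 ((ih _ (by omega)).1 h3)⟩
  -- Downward induction on `b`: beyond `m` both sets are empty.
  have main : ∀ k b, m < b + k → (b ∈ S ↔ b ∈ T) := by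
    intro k
    induction k with
    | zero =>
      intro b hb
      exact ⟨fun h1 => absurd (Finset.mem_Icc.1 (hS h1)) (by omega),
        fun h1 => absurd (Finset.mem_Icc.1 (hT h1)) (by omega)⟩
    | succ k ih =>
      intro b hb
      have ih' : ∀ c, b < c → (c ∈ S ↔ c ∈ T) := fun c hc => ih c (by omega)
      exact ⟨step hS hS' h b ih', step hT hT' h.symm b fun c hc => (ih' c hc).symm⟩
  ext b
  exact main (m + 1) b (by omega)

/-! ### Monomials as weakly increasing words, and jump sets -/

/-- The exponent vector of the monomial of a word. -/
noncomputable def wordContent {α : Type*} {n : ℕ} (w : Fin n → α) : α →₀ ℕ :=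
  ∑ i, Finsupp.single (w i) 1

theorem toMultiset_wordContent {α : Type*} {n : ℕ} (w : Fin n → α) :
    Finsupp.toMultiset (wordContent w) = (List.ofFn w : Multiset α) := by
  rw [wordContent, map_sum, ← Fin.univ_val_map]
  simp only [Finsupp.toMultiset_single, one_nsmul]
  rw [← Multiset.sum_map_singleton (Multiset.map w Finset.univ.val), Multiset.map_map]
  rfl

theorem degree_wordContent {α : Type*} {n : ℕ} (w : Fin n → α) : (wordContent w).degree = n := by
  simp [wordContent, map_sum, Finsupp.degree_single]

theorem wordContent_comp_perm {α : Type*} {n : ℕ} (w : Fin n → α) (σ : Equiv.Perm (Fin n)) :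
    wordContent (w ∘ σ) = wordContent w :=
  Equiv.sum_comp σ fun i => Finsupp.single (w i) 1

theorem mapDomain_wordContent {α β : Type*} {n : ℕ} (φ : α → β) (w : Fin n → α) :
    (wordContent w).mapDomain φ = wordContent (φ ∘ w) := by
  simp [wordContent, Finsupp.mapDomain_finsetSum, Finsupp.mapDomain_single]

theorem exists_monotone_wordContent_eq {α : Type*} [LinearOrder α] (d : α →₀ ℕ) :
    ∃ w : Fin d.degree → α, Monotone w ∧ wordContent w = d := by
  obtain ⟨l, hl⟩ : ∃ l : List α, (l : Multiset α) = Finsupp.toMultiset d :=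
    ⟨_, Multiset.coe_toList _⟩
  have hn : d.degree = l.length := by
    rw [← Multiset.coe_card, hl, Finsupp.card_toMultiset]
    rfl
  rw [hn]
  refine ⟨l.get ∘ Tuple.sort l.get, Tuple.monotone_sort _, ?_⟩
  rw [wordContent_comp_perm]
  classical
  refine (Finsupp.orderIsoMultiset (ι := α)).injective ?_
  rw [Finsupp.coe_orderIsoMultiset, toMultiset_wordContent, List.ofFn_get, hl]

theorem eq_of_wordContent_eq {α : Type*} [LinearOrder α] {n : ℕ} {v w : Fin n → α}
    (hv : Monotone v) (hw : Monotone w) (h : wordContent v = wordContent w) : v = w := by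
  have h1 := congrArg Finsupp.toMultiset h
  rw [toMultiset_wordContent, toMultiset_wordContent, Multiset.coe_eq_coe] at h1
  exact List.ofFn_injective (h1.eq_of_sortedLE hv.sortedLE_ofFn hw.sortedLE_ofFn)

/-- The positions, counted from `1`, after which a word increases strictly. -/
def jumpSet {α : Type*} [LinearOrder α] {m : ℕ} (w : Fin (m + 1) → α) : Finset ℕ :=
  (Finset.univ.filter fun i : Fin m => w i.castSucc < w i.succ).image fun i : Fin m => (i : ℕ) + 1

theorem succ_mem_jumpSet {α : Type*} [LinearOrder α] {m : ℕ} (w : Fin (m + 1) → α) (i : Fin m) :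
    (i : ℕ) + 1 ∈ jumpSet w ↔ w i.castSucc < w i.succ := by
  simp only [jumpSet, Finset.mem_image, Finset.mem_filter, Finset.mem_univ, true_and]
  constructor
  · rintro ⟨j, hj, hji⟩
    rwa [Fin.ext (Nat.succ.inj hji) (b := i)] at hj
  · exact fun h => ⟨i, h, rfl⟩

theorem jumpSet_subset {α : Type*} [LinearOrder α] {m : ℕ} (w : Fin (m + 1) → α) :
    jumpSet w ⊆ Finset.Icc 1 m := by
  intro x hx
  obtain ⟨i, _, rfl⟩ := Finset.mem_image.1 hx
  simp

theorem jumpSet_comp {α β : Type*} [LinearOrder α] [LinearOrder β] {m : ℕ} (w : Fin (m + 1) → α)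
    {φ : α → β} (hφ : StrictMono φ) : jumpSet (φ ∘ w) = jumpSet w := by
  simp [jumpSet, hφ.lt_iff_lt]

theorem exists_monotone_jumpSet_eq (m : ℕ) (J : Finset ℕ) (hJ : J ⊆ Finset.Icc 1 m) :
    ∃ w : Fin (m + 1) → ℕ+, Monotone w ∧ jumpSet w = J := by
  -- The letter at index `i` is one more than the number of elements of `J` up to `i`, so it grows
  -- exactly on entering an element of `J`.
  refine ⟨fun i => Nat.succPNat (J.filter (· ≤ (i : ℕ))).card, ?_, ?_⟩
  · intro i j hij
    refine Nat.succPNat_le_succPNat.2 (Finset.card_le_card fun x hx => ?_)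
    rw [Finset.mem_filter] at hx ⊢
    exact ⟨hx.1, hx.2.trans hij⟩
  · have key : ∀ i : Fin m, (i : ℕ) + 1 ∈ J ↔
        (J.filter (· ≤ (i : ℕ))).card < (J.filter (· ≤ (i : ℕ) + 1)).card := by
      intro i
      have hsub : J.filter (· ≤ (i : ℕ)) ⊆ J.filter (· ≤ (i : ℕ) + 1) := by
        intro x hx
        rw [Finset.mem_filter] at hx ⊢
        exact ⟨hx.1, by omega⟩
      constructor
      · intro h
        refine Finset.card_lt_card (Finset.ssubset_iff_subset_ne.2 ⟨hsub, fun he => ?_⟩)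
        have : (i : ℕ) + 1 ∈ J.filter (· ≤ (i : ℕ)) := by
          rw [he, Finset.mem_filter]
          exact ⟨h, le_rfl⟩
        have := (Finset.mem_filter.1 this).2
        omega
      · intro h
        by_contra h1
        refine h.ne (congrArg Finset.card (Finset.Subset.antisymm hsub fun x hx => ?_))
        rw [Finset.mem_filter] at hx ⊢
        have : x ≠ (i : ℕ) + 1 := fun h2 => h1 (h2 ▸ hx.1)
        exact ⟨hx.1, by omega⟩
    ext x
    constructor
    · intro hx
      have hx' := Finset.mem_Icc.1 (jumpSet_subset _ hx)
      obtain ⟨i, rfl⟩ : ∃ i : Fin m, (i : ℕ) + 1 = x :=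
        ⟨⟨x - 1, by omega⟩, by simp; omega⟩
      rw [succ_mem_jumpSet, Nat.succPNat_lt_succPNat] at hx
      exact (key i).2 hx
    · intro hx
      have hx' := Finset.mem_Icc.1 (hJ hx)
      obtain ⟨i, rfl⟩ : ∃ i : Fin m, (i : ℕ) + 1 = x :=
        ⟨⟨x - 1, by omega⟩, by simp; omega⟩
      rw [succ_mem_jumpSet, Nat.succPNat_lt_succPNat]
      exact (key i).1 hx

/-! ### Coefficients of the fundamentals; quasisymmetry -/

namespace SignedPos

/-- Between equal absolute values, a descent constrains only the left sign (it must be minus) and an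
ascent only the right sign (it must be plus). This gives the transfer kernels. -/
theorem lt_or_eq_and_iff (a b : ℕ+) (hab : a ≤ b) (s t : Bool) (D : Prop) :
    ((toLex (a, s) : SignedPos) < toLex (b, t) ∨
      ((toLex (a, s) : SignedPos) = toLex (b, t) ∧ (IsNeg (toLex (b, t)) ↔ D))) ↔
      a < b ∨ (D ∧ s = false) ∨ (¬ D ∧ t = true) := by
  rw [Prod.Lex.toLex_lt_toLex]
  rcases hab.lt_or_eq with h | rfl
  · simp [h]
  · cases s <;> cases t <;> by_cases D <;> simp_all [IsNeg]

theorem abs_le_abs {y z : SignedPos} (h : y ≤ z) : y.abs ≤ z.abs := by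
  rcases Prod.Lex.le_iff.1 h with h | h
  · exact h.le
  · exact h.1.le

end SignedPos

/-- Read along the chain, the absolute values of an enriched partition increase weakly, so the
monomial forces them to be `w`; only the signs remain free. -/
theorem coeff_qFundamentalPerm (q : ℂ) {m : ℕ} (π : Equiv.Perm (Fin (m + 1)))
    (w : Fin (m + 1) → ℕ+) (hw : Monotone w) :
    MvPowerSeries.coeff (wordContent w) (qFundamentalPerm q π) =
      signSum q m (fundamentalStep (descentSet π) (jumpSet w)) := by
  classical
  let good : (Fin (m + 1) → Bool) → Prop := fun s => ∀ i : Fin m,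
    w i.castSucc < w i.succ ∨ ((i : ℕ) + 1 ∈ descentSet π ∧ s i.castSucc = false) ∨
      ((i : ℕ) + 1 ∉ descentSet π ∧ s i.succ = true)
  let f : (Fin (m + 1) → Bool) → Fin (m + 1) → SignedPos := fun s i => toLex (w i, s i)
  have hgood : ∀ s, (LabelledWeightedPoset.chain π fun _ => 1).IsEnrichedPartition
      (f s ∘ π.symm) ↔ good s := by
    intro s
    rw [chain_isEnrichedPartition_iff]
    have := fun i : Fin m => SignedPos.lt_or_eq_and_iff (w i.castSucc) (w i.succ)
      (hw (Fin.castSucc_lt_succ.le)) (s i.castSucc) (s i.succ) ((i : ℕ) + 1 ∈ descentSet π)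
    constructor
    · intro h i
      exact (this i).1 (h i (Nat.succ_lt_succ i.2))
    · intro h i hi
      exact (this ⟨i, Nat.lt_of_succ_lt_succ hi⟩).2 (h _)
  have hexp : ∀ g : Fin (m + 1) → SignedPos,
      (LabelledWeightedPoset.chain π fun _ => 1).exponent (g ∘ π.symm) =
        wordContent (SignedPos.abs ∘ g) := fun g =>
    wordContent_comp_perm (SignedPos.abs ∘ g) π.symm
  have h1 : MvPowerSeries.coeff (wordContent w) (qFundamentalPerm q π) =
      ∑ᶠ s ∈ {s | good s}, ∏ i, signWeight q (s i) := by
    refine (finsum_mem_eq_of_bijOn (fun s => f s ∘ π.symm) ⟨?_, ?_, ?_⟩ ?_).symm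
    · intro s hs
      exact ⟨(hgood s).2 hs, hexp (f s)⟩
    · intro s _ t _ hst
      have := π.symm.surjective.injective_comp_right hst
      funext i
      exact congrArg (fun z : SignedPos => (ofLex z).2) (congrFun this i)
    · rintro F ⟨hF1, hF2⟩
      obtain ⟨g, rfl⟩ : ∃ g : Fin (m + 1) → SignedPos, F = g ∘ π.symm :=
        ⟨F ∘ π, by funext x; simp⟩
      have hg : SignedPos.abs ∘ g = w := by
        rw [hexp] at hF2
        refine eq_of_wordContent_eq (Fin.monotone_iff_le_succ.2 fun i => ?_) hw hF2
        refine SignedPos.abs_le_abs ?_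
        rcases (chain_isEnrichedPartition_iff π _ g).1 hF1 i (Nat.succ_lt_succ i.2) with h | h
        · exact h.le
        · exact h.1.le
      have hfg : f (fun i => (ofLex (g i)).2) = g := by
        funext i
        simp only [f, ← hg]
        rfl
      refine ⟨fun i => (ofLex (g i)).2, ?_, ?_⟩
      · rw [Set.mem_ofPred_eq]
        refine (hgood fun i => (ofLex (g i)).2).1 ?_
        rw [hfg]
        exact hF1
      · simp only [hfg]
    · intro s _
      rw [← Equiv.prod_comp π.symm]
      refine Finset.prod_congr rfl fun i _ => ?_
      simp only [signWeight, f, SignedPos.IsNeg, Function.comp, ofLex_toLex]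
      rcases Bool.eq_false_or_eq_true (s (π.symm i)) with h | h <;> simp [h]
  rw [h1, finsum_mem_eq_finite_toFinset_sum _ (Set.toFinite _), signSum, Set.Finite.toFinset_ofPred,
    Finset.sum_filter]
  refine Finset.sum_congr rfl fun s _ => ?_
  have h2 : ∏ i : Fin m, fundamentalStep (descentSet π) (jumpSet w) (i + 1)
      (s i.castSucc) (s i.succ) = if good s then 1 else 0 := by
    refine Eq.trans (Finset.prod_congr rfl fun i _ => ?_) ((Fintype.prod_boole (p := fun i : Fin m =>
      w i.castSucc < w i.succ ∨ ((i : ℕ) + 1 ∈ descentSet π ∧ s i.castSucc = false) ∨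
        ((i : ℕ) + 1 ∉ descentSet π ∧ s i.succ = true))).trans (by congr))
    simp only [fundamentalStep, descentStep, ascentStep, succ_mem_jumpSet]
    by_cases h3 : (i : ℕ) + 1 ∈ descentSet π <;> by_cases h4 : w i.castSucc < w i.succ <;>
      cases s i.castSucc <;> cases s i.succ <;> simp [h3, h4]
  rw [h2]
  split_ifs <;> simp

theorem coeff_qFundamental (q : ℂ) {m : ℕ} (I : {I : Finset ℕ // I ⊆ Finset.Icc 1 (m + 1 - 1)})
    (w : Fin (m + 1) → ℕ+) (hw : Monotone w) :
    MvPowerSeries.coeff (wordContent w) (qFundamental q (m + 1) I) =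
      signSum q m (fundamentalStep I.1 (jumpSet w)) := by
  rw [qFundamental, coeff_qFundamentalPerm q _ w hw,
    (exists_perm_descentSet_eq (m + 1) I.1 I.2).choose_spec]

theorem coeff_qFundamental_of_degree_ne (q : ℂ) (n : ℕ)
    (I : {I : Finset ℕ // I ⊆ Finset.Icc 1 (n - 1)}) (d : ℕ+ →₀ ℕ) (h : d.degree ≠ n) :
    MvPowerSeries.coeff d (qFundamental q n I) = 0 := by
  refine finsum_mem_eq_zero_of_forall_eq_zero fun f hf => absurd ?_ h
  rw [← hf.2]
  exact degree_wordContent (SignedPos.abs ∘ f)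

theorem qFundamental_zero (q : ℂ) (I : {I : Finset ℕ // I ⊆ Finset.Icc 1 (0 - 1)}) :
    qFundamental q 0 I = 1 := by
  classical
  ext d
  rw [MvPowerSeries.coeff_one]
  split_ifs with h
  · subst h
    refine (finsum_mem_congr (t := {default}) ?_ fun _ _ => rfl).trans ?_
    · ext f
      simp only [Set.mem_ofPred_eq, Set.mem_singleton_iff, Unique.eq_default, iff_true]
      exact ⟨⟨fun i => i.elim0, fun i => i.elim0⟩, by simp [LabelledWeightedPoset.exponent]⟩
    · rw [finsum_mem_singleton]
      simp
  · refine coeff_qFundamental_of_degree_ne q 0 I d ?_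
    simpa [Finsupp.degree_eq_zero_iff] using h

theorem isQuasisymmetric_qFundamental (q : ℂ) (n : ℕ)
    (I : {I : Finset ℕ // I ⊆ Finset.Icc 1 (n - 1)}) :
    IsQuasisymmetric (qFundamental q n I) := by
  intro m k i hi
  -- Both monomials are images of one monomial in the letters `Fin m` under strictly increasing
  -- maps, which preserve jump sets.
  have hd : ∀ {φ : Fin m → ℕ+}, (∑ j, Finsupp.single (φ j) (k j : ℕ)) =
      (∑ j, Finsupp.single j (k j : ℕ) : Fin m →₀ ℕ).mapDomain φ := fun {φ} => by
    simp [Finsupp.mapDomain_finsetSum, Finsupp.mapDomain_single]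
  have hs : StrictMono fun j : Fin m => Nat.succPNat j := fun a b h => Nat.succPNat_lt_succPNat.2 h
  rw [hd, hd (φ := fun j => Nat.succPNat j)]
  obtain ⟨w, hw, hwd⟩ := exists_monotone_wordContent_eq
    (∑ j, Finsupp.single j (k j : ℕ) : Fin m →₀ ℕ)
  rw [← hwd, mapDomain_wordContent, mapDomain_wordContent]
  generalize (∑ j, Finsupp.single j (k j : ℕ) : Fin m →₀ ℕ).degree = N at w hw
  by_cases hN : N = n
  · subst hN
    rcases N with _ | N
    · congr 2
    · rw [coeff_qFundamental _ _ _ (hi.monotone.comp hw),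
        coeff_qFundamental _ _ _ (hs.monotone.comp hw), jumpSet_comp _ hi, jumpSet_comp _ hs]
  · rw [coeff_qFundamental_of_degree_ne _ _ _ _ (by rwa [degree_wordContent]),
      coeff_qFundamental_of_degree_ne _ _ _ _ (by rwa [degree_wordContent])]

theorem qFundamental_mem_QSym (q : ℂ) (n : ℕ) (I : {I : Finset ℕ // I ⊆ Finset.Icc 1 (n - 1)}) :
    qFundamental q n I ∈ QSym := by
  refine ⟨isQuasisymmetric_qFundamental q n I, n, fun d hd => ?_⟩
  by_contra h
  exact hd (coeff_qFundamental_of_degree_ne q n I d (by omega))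

/-! ### Products through P-partitions and linear extensions -/

namespace LabelledWeightedPoset

theorem coeff_generatingFunction {n : ℕ} (q : ℂ) (P : LabelledWeightedPoset n) (d : ℕ+ →₀ ℕ)
    [DecidablePred P.IsEnrichedPartition] :
    MvPowerSeries.coeff d (P.generatingFunction q) =
      ∑ f ∈ (P.finite_exponent_eq d).toFinset with P.IsEnrichedPartition f,
        ∏ i, (if (f i).IsNeg then q else 1) := by
  refine finsum_mem_eq_sum_of_inter_support_eq _ ?_
  congr 1
  ext f
  simp [and_comm]

/-- The comparison key of a map `f`: the values of `f`, ties being broken by the labels, in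
increasing order at positive values and in decreasing order at negative values. -/
def enrichedKey {n : ℕ} (f : Fin n → SignedPos) (i : Fin n) : SignedPos ×ₗ ℤ :=
  toLex (f i, if (f i).IsNeg then -(i : ℤ) else i)

theorem enrichedKey_injective {n : ℕ} (f : Fin n → SignedPos) :
    Function.Injective (enrichedKey f) := by
  intro a b hab
  have h1 : f a = f b := congrArg (fun z : SignedPos ×ₗ ℤ => (ofLex z).1) hab
  have h2 : (if (f a).IsNeg then -(a : ℤ) else a) = if (f b).IsNeg then -(b : ℤ) else b :=
    congrArg (fun z : SignedPos ×ₗ ℤ => (ofLex z).2) hab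
  rw [h1] at h2
  ext
  split_ifs at h2 <;> omega

/-- Both tie-breaking rules become a single strict inequality in one total order, so that sorting
applies. -/
theorem isEnrichedPartition_iff_enrichedKey {n : ℕ} (P : LabelledWeightedPoset n)
    (f : Fin n → SignedPos) :
    P.IsEnrichedPartition f ↔ ∀ i j, P.lt i j → enrichedKey f i < enrichedKey f j := by
  have hnp : ∀ z : SignedPos, z.IsPos ↔ ¬ z.IsNeg := by
    intro z
    simp [SignedPos.IsPos, SignedPos.IsNeg]
  have key : ∀ i j, enrichedKey f i < enrichedKey f j ↔ f i < f j ∨ (f i = f j ∧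
      ((i < j ∧ (f i).IsPos) ∨ (j < i ∧ (f i).IsNeg))) := by
    intro i j
    rw [enrichedKey, enrichedKey, Prod.Lex.toLex_lt_toLex]
    refine or_congr Iff.rfl (and_congr_right fun h => ?_)
    simp only at h ⊢
    rw [← h, hnp]
    by_cases h1 : (f i).IsNeg <;> simp [h1]
  constructor
  · rintro ⟨h1, h2⟩ i j hij
    rw [key]
    rcases lt_trichotomy i j with h | rfl | h
    · rcases h1 i j hij h with h3 | h3
      · exact Or.inl h3
      · exact Or.inr ⟨h3.1, Or.inl ⟨h, h3.2⟩⟩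
    · exact absurd hij (P.irrefl i)
    · rcases h2 i j hij h with h3 | h3
      · exact Or.inl h3
      · exact Or.inr ⟨h3.1, Or.inr ⟨h, h3.2⟩⟩
  · intro H
    constructor
    · intro i j hij h
      rcases (key i j).1 (H i j hij) with h3 | ⟨h3, h4 | h4⟩
      · exact Or.inl h3
      · exact Or.inr ⟨h3, h4.2⟩
      · exact absurd h4.1 h.not_gt
    · intro i j hij h
      rcases (key i j).1 (H i j hij) with h3 | ⟨h3, h4 | h4⟩
      · exact Or.inl h3
      · exact absurd h4.1 h.not_gt
      · exact Or.inr ⟨h3, h4.2⟩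

theorem chain_isEnrichedPartition_iff_strictMono {n : ℕ} (τ : Equiv.Perm (Fin n)) (α : Fin n → ℕ+)
    (f : Fin n → SignedPos) :
    (chain τ α).IsEnrichedPartition f ↔ StrictMono (enrichedKey f ∘ τ) := by
  rw [isEnrichedPartition_iff_enrichedKey]
  constructor
  · intro h i j hij
    exact h _ _ (by simpa [chain] using hij)
  · intro h i j hij
    simpa using h hij

theorem existsUnique_perm_chain_isEnrichedPartition {n : ℕ} (α : Fin n → ℕ+)
    (f : Fin n → SignedPos) :
    ∃! τ : Equiv.Perm (Fin n), (chain τ α).IsEnrichedPartition f := by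
  simp only [chain_isEnrichedPartition_iff_strictMono]
  refine ⟨Tuple.sort (enrichedKey f), (Tuple.monotone_sort _).strictMono_of_injective
    ((enrichedKey_injective f).comp (Equiv.injective _)), fun σ hσ => Equiv.ext fun i => ?_⟩
  exact enrichedKey_injective f (congrFun (Tuple.unique_monotone hσ.monotone
    (Tuple.monotone_sort (enrichedKey f))) i)

/-- `τ` is a linear extension of `P`. -/
def IsLinearExtension {n : ℕ} (P : LabelledWeightedPoset n) (τ : Equiv.Perm (Fin n)) : Prop :=
  ∀ i j, P.lt i j → τ.symm i < τ.symm j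

theorem isLinearExtension_iff {n : ℕ} (P : LabelledWeightedPoset n) (τ : Equiv.Perm (Fin n))
    (α : Fin n → ℕ+) (f : Fin n → SignedPos) (h : (chain τ α).IsEnrichedPartition f) :
    P.IsLinearExtension τ ↔ P.IsEnrichedPartition f := by
  rw [chain_isEnrichedPartition_iff_strictMono] at h
  rw [isEnrichedPartition_iff_enrichedKey]
  refine forall₂_congr fun i j => imp_congr_right fun _ => ?_
  rw [← h.lt_iff_lt]
  simp

/-- Each `f` is an enriched partition of exactly one chain `τ`, the one sorting its keys, and `f`
respects `P` exactly when `τ` extends `P`. Unit weights make the exponents of `P` and of the chains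
agree. -/
theorem generatingFunction_eq_sum_linearExtension {n : ℕ} (q : ℂ) (P : LabelledWeightedPoset n)
    (hP : P.weight = fun _ => 1) [DecidablePred P.IsLinearExtension] :
    P.generatingFunction q = ∑ τ with P.IsLinearExtension τ, qFundamentalPerm q τ := by
  classical
  ext d
  rw [map_sum, coeff_generatingFunction]
  simp only [qFundamentalPerm, qUniversal, coeff_generatingFunction]
  have hexp : ∀ τ, (((chain τ fun _ => 1).finite_exponent_eq d).toFinset : Finset _) =
      (P.finite_exponent_eq d).toFinset := by
    intro τ
    ext f
    simp [exponent, chain, hP]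
  simp only [hexp]
  rw [Finset.sum_filter, Finset.sum_congr rfl fun τ _ => Finset.sum_filter _ _, Finset.sum_comm]
  refine Finset.sum_congr rfl fun f _ => ?_
  obtain ⟨τ, hτ, huniq⟩ := existsUnique_perm_chain_isEnrichedPartition (fun _ => 1) f
  rw [Finset.sum_filter, Finset.sum_eq_single τ]
  · rw [if_pos hτ]
    exact if_congr (P.isLinearExtension_iff τ _ f hτ).symm rfl rfl
  · intro σ _ hσ
    rw [if_neg fun h => hσ (huniq σ h), ite_self]
  · exact fun h => absurd (Finset.mem_univ _) h

/-- The disjoint union of two posets, the labels of the second being larger than those of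
the first. -/
def disjointUnion {m n : ℕ} (P : LabelledWeightedPoset m) (Q : LabelledWeightedPoset n) :
    LabelledWeightedPoset (m + n) where
  lt a b := (∃ i j, Fin.castAdd n i = a ∧ Fin.castAdd n j = b ∧ P.lt i j) ∨
    ∃ i j, Fin.natAdd m i = a ∧ Fin.natAdd m j = b ∧ Q.lt i j
  irrefl := by
    rintro a (⟨i, j, rfl, h, h'⟩ | ⟨i, j, rfl, h, h'⟩)
    · rw [Fin.castAdd_injective m n h] at h'
      exact P.irrefl _ h'
    · rw [Fin.natAdd_injective n m h] at h'
      exact Q.irrefl _ h'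
  trans := by
    rintro a b c (⟨i, j, rfl, rfl, h⟩ | ⟨i, j, rfl, rfl, h⟩)
      (⟨i', j', h1, rfl, h'⟩ | ⟨i', j', h1, rfl, h'⟩)
    · rw [Fin.castAdd_injective m n h1] at h'
      exact Or.inl ⟨_, _, rfl, rfl, P.trans _ _ _ h h'⟩
    · have := congrArg Fin.val h1
      have := j.2
      simp at *
      omega
    · have := congrArg Fin.val h1
      have := i'.2
      simp at *
      omega
    · rw [Fin.natAdd_injective n m h1] at h'
      exact Or.inr ⟨_, _, rfl, rfl, Q.trans _ _ _ h h'⟩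
  weight := Fin.append P.weight Q.weight

theorem disjointUnion_isEnrichedPartition_append {m n : ℕ} (P : LabelledWeightedPoset m)
    (Q : LabelledWeightedPoset n) (f : Fin m → SignedPos) (g : Fin n → SignedPos) :
    (P.disjointUnion Q).IsEnrichedPartition (Fin.append f g) ↔
      P.IsEnrichedPartition f ∧ Q.IsEnrichedPartition g := by
  constructor
  · rintro ⟨h1, h2⟩
    refine ⟨⟨fun i j h h' => ?_, fun i j h h' => ?_⟩, fun i j h h' => ?_, fun i j h h' => ?_⟩
    · simpa using h1 _ _ (Or.inl ⟨i, j, rfl, rfl, h⟩) h'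
    · simpa using h2 _ _ (Or.inl ⟨i, j, rfl, rfl, h⟩) h'
    · simpa using h1 _ _ (Or.inr ⟨i, j, rfl, rfl, h⟩) (by simpa using h')
    · simpa using h2 _ _ (Or.inr ⟨i, j, rfl, rfl, h⟩) (by simpa using h')
  · rintro ⟨⟨h1, h2⟩, h3, h4⟩
    constructor
    · rintro a b (⟨i, j, rfl, rfl, h⟩ | ⟨i, j, rfl, rfl, h⟩) h'
      · simpa using h1 i j h h'
      · simpa using h3 i j h (by simpa using h')
    · rintro a b (⟨i, j, rfl, rfl, h⟩ | ⟨i, j, rfl, rfl, h⟩) h'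
      · simpa using h2 i j h h'
      · simpa using h4 i j h (by simpa using h')

theorem disjointUnion_exponent_append {m n : ℕ} (P : LabelledWeightedPoset m)
    (Q : LabelledWeightedPoset n) (f : Fin m → SignedPos) (g : Fin n → SignedPos) :
    (P.disjointUnion Q).exponent (Fin.append f g) = P.exponent f + Q.exponent g := by
  simp [exponent, disjointUnion, Fin.sum_univ_add]

/-- Enriched partitions of the disjoint union are the concatenations of pairs, and exponents and
sign weights split accordingly. -/
theorem generatingFunction_mul {m n : ℕ} (q : ℂ) (P : LabelledWeightedPoset m)
    (Q : LabelledWeightedPoset n) :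
    P.generatingFunction q * Q.generatingFunction q =
      (P.disjointUnion Q).generatingFunction q := by
  classical
  ext d
  rw [MvPowerSeries.coeff_mul, coeff_generatingFunction]
  simp only [coeff_generatingFunction, Finset.sum_mul_sum, ← Finset.sum_product']
  rw [Finset.sum_sigma']
  refine Finset.sum_bij' (fun x _ => Fin.append x.2.1 x.2.2)
    (fun F _ => ⟨(P.exponent fun i => F (Fin.castAdd n i), Q.exponent fun i => F (Fin.natAdd m i)),
      (fun i => F (Fin.castAdd n i), fun i => F (Fin.natAdd m i))⟩) ?_ ?_ ?_ ?_ ?_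
  · rintro ⟨⟨a, b⟩, f, g⟩ h
    simp only [Finset.mem_sigma, Finset.mem_product, Finset.mem_filter,
      Set.Finite.mem_toFinset, Set.mem_ofPred_eq] at h ⊢
    obtain ⟨hab, ⟨rfl, h1⟩, rfl, h2⟩ := h
    obtain rfl := Finset.HasAntidiagonal.mem_antidiagonal.1 hab
    exact ⟨disjointUnion_exponent_append P Q f g,
      (disjointUnion_isEnrichedPartition_append P Q f g).2 ⟨h1, h2⟩⟩
  · intro F h
    simp only [Finset.mem_sigma, Finset.mem_product, Finset.mem_filter,
      Set.Finite.mem_toFinset, Set.mem_ofPred_eq] at h ⊢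
    rw [← Fin.append_castAdd_natAdd (f := F), disjointUnion_exponent_append,
      disjointUnion_isEnrichedPartition_append] at h
    exact ⟨Finset.HasAntidiagonal.mem_antidiagonal.2 h.1, ⟨trivial, h.2.1⟩, trivial, h.2.2⟩
  · rintro ⟨⟨a, b⟩, f, g⟩ h
    simp only [Finset.mem_sigma, Finset.mem_product, Finset.mem_filter,
      Set.Finite.mem_toFinset, Set.mem_ofPred_eq] at h
    obtain ⟨hab, ⟨rfl, h1⟩, rfl, h2⟩ := h
    obtain rfl := Finset.HasAntidiagonal.mem_antidiagonal.1 hab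
    simp
  · intro F _
    exact Fin.append_castAdd_natAdd
  · rintro ⟨⟨a, b⟩, f, g⟩ _
    simp [Fin.prod_univ_add]

end LabelledWeightedPoset

theorem qFundamental_mul_mem_span (q : ℂ) (s t : SetIndex) :
    qFundamental q s.1 s.2 * qFundamental q t.1 t.2 ∈
      Submodule.span ℂ (Set.range fun u : SetIndex => qFundamental q u.1 u.2) := by
  classical
  simp only [qFundamental, qFundamentalPerm, qUniversal]
  rw [LabelledWeightedPoset.generatingFunction_mul,
    LabelledWeightedPoset.generatingFunction_eq_sum_linearExtension]
  · refine Submodule.sum_mem _ fun τ _ => Submodule.subset_span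
      ⟨⟨_, ⟨descentSet τ, Finset.filter_subset _ _⟩⟩, ?_⟩
    exact (qFundamentalPerm_eq_qFundamental q τ).symm
  · funext i
    refine Fin.addCases (fun i => ?_) (fun i => ?_) i <;>
      simp [LabelledWeightedPoset.disjointUnion, LabelledWeightedPoset.chain]

/-! ### Triangular families and the alternating fundamentals -/

/-- In a vanishing combination, let `k` have maximal rank among the indices with nonzero
coefficient. Applying `φ k` leaves only the term of `k`. -/
theorem LinearMap.linearIndependent_of_triangular {K ι M : Type*} [Field K] [AddCommGroup M]
    [Module K M] (v : ι → M) (φ : ι → M →ₗ[K] K) (r : ι → ℕ) (h0 : ∀ i, φ i (v i) ≠ 0)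
    (h : ∀ i j, φ i (v j) ≠ 0 → i = j ∨ r i < r j) : LinearIndependent K v := by
  classical
  rw [linearIndependent_iff']
  intro s g hsum i hi
  by_contra hgi
  obtain ⟨k, hk, hmax⟩ := Finset.exists_max_image (s.filter fun i => g i ≠ 0) r
    ⟨i, Finset.mem_filter.2 ⟨hi, hgi⟩⟩
  rw [Finset.mem_filter] at hk
  have h1 := congrArg (φ k) hsum
  rw [map_sum, map_zero, Finset.sum_eq_single_of_mem k hk.1, map_smul, smul_eq_mul] at h1
  · exact (mul_ne_zero hk.2 (h0 k)) h1
  · intro j hj hjk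
    rw [map_smul, smul_eq_mul]
    by_contra h2
    rcases h k j (right_ne_zero_of_mul h2) with h3 | h3
    · exact hjk h3.symm
    · exact (hmax j (Finset.mem_filter.2 ⟨hj, left_ne_zero_of_mul h2⟩)).not_gt h3

theorem exists_monotone_wordContent_eq_of_degree_eq {α : Type*} [LinearOrder α] {n : ℕ}
    (d : α →₀ ℕ) (h : d.degree = n) : ∃ w : Fin n → α, Monotone w ∧ wordContent w = d := by
  subst h
  exact exists_monotone_wordContent_eq d

/-- The value of `c` at the jump set of the increasing word with exponent vector `d`, if that
word has length `m + 1`. -/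
noncomputable def jumpSetValue (m : ℕ) (c : Finset ℕ → ℂ) (d : ℕ+ →₀ ℕ) : ℂ :=
  if h : d.degree = m + 1 then
    c (jumpSet (exists_monotone_wordContent_eq_of_degree_eq d h).choose) else 0

/-- The homogeneous quasisymmetric function of degree `m + 1` with prescribed coefficients, as
a function of the jump set of the increasing word of a monomial. -/
noncomputable def wordSeries (m : ℕ) : (Finset ℕ → ℂ) →ₗ[ℂ] MvPowerSeries ℕ+ ℂ where
  toFun c := jumpSetValue m c
  map_add' a b := by
    funext d
    change jumpSetValue m (a + b) d = jumpSetValue m a d + jumpSetValue m b d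
    unfold jumpSetValue
    split_ifs <;> simp
  map_smul' a b := by
    funext d
    change jumpSetValue m (a • b) d = a * jumpSetValue m b d
    unfold jumpSetValue
    split_ifs <;> simp

theorem coeff_wordSeries {m : ℕ} (c : Finset ℕ → ℂ) (w : Fin (m + 1) → ℕ+) (hw : Monotone w) :
    MvPowerSeries.coeff (wordContent w) (wordSeries m c) = c (jumpSet w) := by
  have h := degree_wordContent w
  have hs := (exists_monotone_wordContent_eq_of_degree_eq _ h).choose_spec
  refine (dif_pos h).trans ?_
  rw [eq_of_wordContent_eq hs.1 hw hs.2]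

theorem coeff_wordSeries_of_degree_ne {m : ℕ} (c : Finset ℕ → ℂ) (d : ℕ+ →₀ ℕ)
    (h : d.degree ≠ m + 1) : MvPowerSeries.coeff d (wordSeries m c) = 0 :=
  dif_neg h

theorem qFundamental_succ (q : ℂ) (m : ℕ) (I : {I : Finset ℕ // I ⊆ Finset.Icc 1 (m + 1 - 1)}) :
    qFundamental q (m + 1) I = wordSeries m fun J => signSum q m (fundamentalStep I.1 J) := by
  ext d
  by_cases h : d.degree = m + 1
  · obtain ⟨w, hw, rfl⟩ := exists_monotone_wordContent_eq_of_degree_eq d h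
    rw [coeff_qFundamental q I w hw, coeff_wordSeries _ w hw]
  · rw [coeff_qFundamental_of_degree_ne q _ I d h, coeff_wordSeries_of_degree_ne _ d h]

/-- The alternating sums of the `q`-fundamentals over the subsets of a set. -/
noncomputable def alternatingFundamental (q : ℂ) : ℕ → Finset ℕ → MvPowerSeries ℕ+ ℂ
  | 0, _ => 1
  | m + 1, S => wordSeries m fun J => signSum q m (alternatingStep S J)

theorem qFundamental_eq_sum_alternatingFundamental (q : ℂ) (n : ℕ)
    (I : {I : Finset ℕ // I ⊆ Finset.Icc 1 (n - 1)}) :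
    qFundamental q n I = ∑ S ∈ I.1.powerset, alternatingFundamental q n S := by
  rcases n with _ | m
  · obtain ⟨I, hI⟩ := I
    obtain rfl : I = ∅ := Finset.subset_empty.1 hI
    rw [qFundamental_zero]
    simp [alternatingFundamental]
  · simp only [qFundamental_succ, alternatingFundamental]
    rw [← map_sum]
    congr 1
    funext J
    rw [Finset.sum_apply, signSum_fundamentalStep q m I.1 J I.2]

/-! ### Spanning by extended peak sets -/

theorem isExtendedPeakSet_empty {p : ℕ} (hp : 1 ≤ p) : IsExtendedPeakSet p ∅ := by
  intro a h
  have := h (Finset.right_mem_Icc.2 (Nat.le_add_right a p))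
  simp at this
  omega

theorem alternatingFundamental_mem_of_isExtendedPeakSet {q : ℂ} {p : ℕ} (hp : 1 ≤ p)
    (hq : IsPrimitiveRoot (-q) (p + 1)) (n : ℕ) (V : Submodule ℂ (MvPowerSeries ℕ+ ℂ))
    (hV : ∀ S ⊆ Finset.Icc 1 (n - 1), IsExtendedPeakSet p S → alternatingFundamental q n S ∈ V)
    (S : Finset ℕ) (hS : S ⊆ Finset.Icc 1 (n - 1)) : alternatingFundamental q n S ∈ V := by
  induction S using Finset.strongInduction with
  | H S ih =>
  by_cases h : IsExtendedPeakSet p S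
  · exact hV S hS h
  · rcases n with _ | m
    -- In degree `0` only `S = ∅` occurs, and it is an extended peak set because `p ≥ 1`.
    · exact absurd (Finset.subset_empty.1 hS ▸ isExtendedPeakSet_empty hp) h
    · obtain ⟨x, hx, rfl | hxS⟩ := exists_gap_of_not_isExtendedPeakSet hp hS h
      · have : alternatingFundamental q (m + 1) S = 0 := by
          rw [alternatingFundamental, ← map_zero (wordSeries m)]
          congr 1
          funext J
          exact signSum_alternatingStep_eq_zero J hq hS hx
        rw [this]
        exact V.zero_mem
      · have : alternatingFundamental q (m + 1) S =
            -alternatingFundamental q (m + 1) (S.erase x) := by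
          rw [alternatingFundamental, alternatingFundamental, ← map_neg (wordSeries m)]
          congr 1
          funext J
          exact signSum_alternatingStep_erase J hq hS hx hxS
        rw [this]
        exact V.neg_mem (ih _ (Finset.erase_ssubset hxS) ((Finset.erase_subset _ _).trans hS))

theorem span_qFundamental_isExtendedPeakSet {q : ℂ} {p : ℕ} (hp : 1 ≤ p)
    (hq : IsPrimitiveRoot (-q) (p + 1)) :
    Submodule.span ℂ (Set.range fun s : {s : SetIndex // IsExtendedPeakSet p s.2} =>
      qFundamental q s.1.1 s.1.2) =
      Submodule.span ℂ (Set.range fun s : SetIndex => qFundamental q s.1 s.2) := by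
  refine le_antisymm (Submodule.span_mono ?_) (Submodule.span_le.2 ?_)
  · rintro _ ⟨s, rfl⟩
    exact ⟨s.1, rfl⟩
  · rintro _ ⟨⟨n, I⟩, rfl⟩
    simp only [qFundamental_eq_sum_alternatingFundamental, SetLike.mem_coe]
    refine Submodule.sum_mem _ fun S hS =>
      alternatingFundamental_mem_of_isExtendedPeakSet hp hq n _ (fun T hT hTp => ?_) S
        ((Finset.mem_powerset.1 hS).trans I.2)
    clear hS S
    induction T using Finset.strongInduction with
    | H S ih =>
    have h1 := Submodule.subset_span (R := ℂ) (Set.mem_range_self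
      (f := fun s : {s : SetIndex // IsExtendedPeakSet p s.2} =>
        ∑ S ∈ s.1.2.1.powerset, alternatingFundamental q s.1.1 S) ⟨⟨n, S, hT⟩, hTp⟩)
    simp only at h1
    -- `N_S` is `L_S` minus the `N_R` of the proper subsets `R`, which are again extended peak sets.
    rw [← Finset.sum_erase_add _ _ (Finset.mem_powerset_self S)] at h1
    refine (Submodule.add_mem_iff_right _ (Submodule.sum_mem _ fun R hR => ?_)).1 h1
    rw [Finset.mem_erase, Finset.mem_powerset] at hR
    exact ih R (Finset.ssubset_iff_subset_ne.2 ⟨hR.2, hR.1⟩) (hR.2.trans hT) (hTp.mono hR.2)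

/-! ### Linear independence -/

theorem linearIndependent_alternatingFundamental {q : ℂ} {p : ℕ}
    (hq : IsPrimitiveRoot (-q) (p + 1)) :
    LinearIndependent ℂ fun s : {s : SetIndex // IsExtendedPeakSet p s.2} =>
      alternatingFundamental q s.1.1 s.1.2.1 := by
  -- The test functional is the coefficient at a word whose jump set is the leading one (the
  -- constant term in degree `0`). Any `N_T` of the same degree that it detects has a leading set
  -- containing this one.
  have key : ∀ s : {s : SetIndex // IsExtendedPeakSet p s.2}, ∃ d : ℕ+ →₀ ℕ,
      MvPowerSeries.coeff d (alternatingFundamental q s.1.1 s.1.2.1) ≠ 0 ∧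
      ∀ t : {s : SetIndex // IsExtendedPeakSet p s.2},
        MvPowerSeries.coeff d (alternatingFundamental q t.1.1 t.1.2.1) ≠ 0 →
        s = t ∨ (leadingJumpSet p (s.1.1 - 1) s.1.2.1).card <
          (leadingJumpSet p (t.1.1 - 1) t.1.2.1).card := by
    rintro ⟨⟨_ | m, S, hS⟩, hSp⟩
    · refine ⟨0, by simp [alternatingFundamental], ?_⟩
      rintro ⟨⟨_ | n, T, hT⟩, hTp⟩ ht
      · obtain rfl : S = ∅ := Finset.subset_empty.1 hS
        obtain rfl : T = ∅ := Finset.subset_empty.1 hT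
        exact Or.inl rfl
      · exact absurd (coeff_wordSeries_of_degree_ne _ _ (by simp)) ht
    · obtain ⟨w, hw, hwJ⟩ := exists_monotone_jumpSet_eq m (leadingJumpSet p m S)
        (Finset.filter_subset _ _)
      refine ⟨wordContent w, ?_, ?_⟩
      · simp only [alternatingFundamental]
        rw [coeff_wordSeries _ w hw, hwJ]
        exact signSum_alternatingStep_leadingJumpSet_ne_zero hq hS hSp
      · rintro ⟨⟨_ | n, T, hT⟩, hTp⟩ ht
        · refine absurd (MvPowerSeries.coeff_one (R := ℂ) (wordContent w)) ?_
          rw [if_neg]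
          · exact ht
          · intro h
            have := degree_wordContent w
            rw [h] at this
            simp at this
        · by_cases hmn : m = n
          · subst hmn
            simp only [alternatingFundamental] at ht
            rw [coeff_wordSeries _ w hw, hwJ] at ht
            have hsub := subset_leadingJumpSet hq hT (Finset.filter_subset _ _) ht
            rcases hsub.eq_or_ssubset with h | h
            · left
              obtain rfl := leadingJumpSet_injOn hS hT hSp hTp h
              rfl
            · exact Or.inr (Finset.card_lt_card h)
          · refine absurd (coeff_wordSeries_of_degree_ne _ _ ?_) ht
            rw [degree_wordContent]
            omega
  choose d hd0 hd using key
  exact LinearMap.linearIndependent_of_triangular _ (fun s => MvPowerSeries.coeff (d s)) _ hd0 hd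

theorem linearIndependent_qFundamental {q : ℂ} {p : ℕ} (hq : IsPrimitiveRoot (-q) (p + 1)) :
    LinearIndependent ℂ fun s : {s : SetIndex // IsExtendedPeakSet p s.2} =>
      qFundamental q s.1.1 s.1.2 := by
  classical
  have hN := linearIndependent_alternatingFundamental hq
  -- `g` reads off coordinates in the family `N`. The `N_S`-coordinate of `L_T` is nonzero only if
  -- `S ⊆ T` in the same degree, which is triangular for the cardinality.
  obtain ⟨g, hg⟩ := LinearMap.exists_leftInverse_of_injective _
    (LinearMap.ker_eq_bot.2 hN)
  have hgN : ∀ (s : {s : SetIndex // IsExtendedPeakSet p s.2}) (n : ℕ) (S : Finset ℕ),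
      S ⊆ Finset.Icc 1 (n - 1) → IsExtendedPeakSet p S →
      g (alternatingFundamental q n S) s = if n = s.1.1 ∧ S = s.1.2.1 then 1 else 0 := by
    rintro ⟨⟨n', S', hS'⟩, hSp'⟩ n S hS hSp
    have h1 := LinearMap.congr_fun hg (Finsupp.single ⟨⟨n, S, hS⟩, hSp⟩ 1)
    simp only [LinearMap.comp_apply, Finsupp.linearCombination_single, one_smul,
      LinearMap.id_apply] at h1
    rw [h1, Finsupp.single_apply]
    refine if_congr ?_ rfl rfl
    constructor
    · intro h
      obtain ⟨rfl, h⟩ := Sigma.mk.inj (Subtype.mk.inj h)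
      exact ⟨rfl, Subtype.mk.inj (eq_of_heq h)⟩
    · rintro ⟨rfl, rfl⟩
      rfl
  have hgL : ∀ s t : {s : SetIndex // IsExtendedPeakSet p s.2},
      g (qFundamental q t.1.1 t.1.2) s =
        ∑ S ∈ t.1.2.1.powerset, if t.1.1 = s.1.1 ∧ S = s.1.2.1 then 1 else 0 := by
    intro s t
    rw [qFundamental_eq_sum_alternatingFundamental, map_sum, Finsupp.finsetSum_apply]
    exact Finset.sum_congr rfl fun S hS => hgN s _ S ((Finset.mem_powerset.1 hS).trans t.1.2.2)
      (t.2.mono (Finset.mem_powerset.1 hS))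
  refine LinearMap.linearIndependent_of_triangular _ (fun s => Finsupp.lapply s ∘ₗ g)
    (fun s => s.1.2.1.card) (fun s => ?_) fun s t h => ?_
  · simp [hgL]
  · simp only [LinearMap.comp_apply, Finsupp.lapply_apply, hgL] at h
    obtain ⟨S, hS, h1⟩ := Finset.exists_ne_zero_of_sum_ne_zero h
    obtain ⟨⟨n, I, hI⟩, hIp⟩ := s
    obtain ⟨⟨n', I', hI'⟩, hIp'⟩ := t
    obtain ⟨rfl, rfl⟩ : n' = n ∧ S = I := by
      by_contra h2
      exact h1 (if_neg h2)
    rcases (Finset.mem_powerset.1 hS).eq_or_ssubset with h2 | h2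
    · left
      simp only at h2
      subst h2
      rfl
    · exact Or.inr (Finset.card_lt_card h2)

/-! ### The root of unity and the conclusion -/

theorem isPrimitiveRoot_neg_rho (p : ℕ) : IsPrimitiveRoot (-rho p) (p + 1) := by
  have h := Complex.isPrimitiveRoot_exp (p + 1) (Nat.succ_ne_zero p)
  have h0 : ((p : ℂ) + 1) ≠ 0 := Nat.cast_add_one_ne_zero p
  convert h using 1
  -- With `-1 = exp(πi)`, the angle is `π - π(p - 1)/(p + 1) = 2π/(p + 1)`.
  rw [rho, ← neg_one_mul, ← Complex.exp_pi_mul_I, ← Complex.exp_add]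
  congr 1
  push_cast
  field_simp
  ring

theorem submodule_span_subset_QSym {X : Set (MvPowerSeries ℕ+ ℂ)} (hX : X ⊆ QSym) :
    (Submodule.span ℂ X : Set (MvPowerSeries ℕ+ ℂ)) ⊆ QSym := by
  intro F hF
  induction hF using Submodule.span_induction with
  | mem x hx => exact hX hx
  | zero => exact ⟨fun m k i _ => by simp, 0, fun d hd => absurd (map_zero _) hd⟩
  | add x y _ _ hx hy =>
    obtain ⟨hx, M, hM⟩ := hx
    obtain ⟨hy, N, hN⟩ := hy
    refine ⟨fun m k i hi => by rw [map_add, map_add, hx m k i hi, hy m k i hi], max M N,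
      fun d hd => ?_⟩
    by_contra! h
    rw [max_lt_iff] at h
    refine hd ?_
    rw [map_add, not_not.1 (fun h1 => (hM d h1).not_gt h.1),
      not_not.1 (fun h1 => (hN d h1).not_gt h.2), add_zero]
  | smul a x _ hx =>
    obtain ⟨hx, M, hM⟩ := hx
    refine ⟨fun m k i hi => by rw [map_smul, map_smul, hx m k i hi], M, fun d hd => hM d ?_⟩
    intro h
    rw [map_smul, h, smul_zero] at hd
    exact hd rfl

theorem theorem3 (p : ℕ) (hp : 1 ≤ p) :
    ∃ A : Subalgebra ℂ (MvPowerSeries ℕ+ ℂ),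
      Subalgebra.toSubmodule A = extendedPeakSpan p ∧
      (A : Set (MvPowerSeries ℕ+ ℂ)) ⊆ QSym ∧
      ∃ b : Module.Basis {s : SetIndex // IsExtendedPeakSet p s.2} ℂ A,
        ∀ s, (b s : MvPowerSeries ℕ+ ℂ) = extendedPeakFunction p s.1 := by
  have hone : (1 : MvPowerSeries ℕ+ ℂ) ∈ extendedPeakSpan p :=
    Submodule.subset_span ⟨⟨0, ∅, Finset.empty_subset _⟩, qFundamental_zero _ _⟩
  have hmul : extendedPeakSpan p * extendedPeakSpan p ≤ extendedPeakSpan p := by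
    rw [extendedPeakSpan, Submodule.span_mul_span, Submodule.span_le]
    rintro _ ⟨_, ⟨s, rfl⟩, _, ⟨t, rfl⟩, rfl⟩
    exact qFundamental_mul_mem_span (rho p) s t
  have hspan := span_qFundamental_isExtendedPeakSet hp (isPrimitiveRoot_neg_rho p)
  have hind := linearIndependent_qFundamental (isPrimitiveRoot_neg_rho p)
  refine ⟨(extendedPeakSpan p).toSubalgebra hone fun x y hx hy => hmul (Submodule.mul_mem_mul hx hy),
    Submodule.toSubalgebra_toSubmodule _ _ _, submodule_span_subset_QSym ?_,
    (Module.Basis.span hind).map (LinearEquiv.ofEq _ _ hspan), fun s => ?_⟩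
  · rintro _ ⟨s, rfl⟩
    exact qFundamental_mem_QSym _ _ _
  · exact congrArg Subtype.val (Module.Basis.span_apply hind s)
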